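/- Let $G:\mathbb R\to\mathbb R$ be twice continuously differentiable, not a polynomial of degree at most $2$, with $\mathrm E[G(N)]=0$ for $N\sim N(0,1)$; write $g=G'$. Let $\boldsymbol x_1,\boldsymbol x_2,\dots$ be i.i.d. with $\boldsymbol x_i=\boldsymbol\mu+\boldsymbol z_i$ (the independent component model with mixing matrix $\boldsymbol I_p$), where $\boldsymbol z_i=(z_{i1},\dots,z_{ip})^T$ has mutually independent components such that (A1) at most one component is Gaussian; (A2) $\mathrm E(z_{ij})=0$ and $\mathrm E(z_{ij}^2)=1$; (A3) the moments $\mathrm E[z_{ij}^4]$, $\nu_j=\mathrm E[G(z_{ij})]$, $\mu_j=\mathrm E[g(z_{ij})]$, $\mathrm{Var}[g(z_{ij})]$, $\lambda_j=\mathrm E[g(z_{ij})z_{ij}]$, $\delta_j=\mathrm E[g'(z_{ij})]$, $\tau_j=\mathrm E[g'(z_{ij})z_{ij}]$ exist and are finite; and, as regularity condition, for every $j$ there is $\varepsilon>0$ with $$\mathrm E\Big[(1+\|\boldsymbol z_i\|^2)\sup_{|t-z_{ij}|\le\varepsilon(1+\|\boldsymbol z_i\|)}|g'(t)|\Big]<\infty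 .$$ Let $s_j=\mathrm{sign}(\nu_j)$, and assume $\nu_j(\lambda_j-\delta_j)\ge 0$ for all $j$, with equality for at most one $j$. For the sample $\boldsymbol x_1,\dots,\boldsymbol x_n$ let $\bar{\boldsymbol x}$ be the mean, $\hat{\boldsymbol S}=\frac1n\sum_i(\boldsymbol x_i-\bar{\boldsymbol x})(\boldsymbol x_i-\bar{\boldsymbol x})^T$, $\hat\nu(\boldsymbol\gamma)=\frac1n\sum_i G(\boldsymbol\gamma^T(\boldsymbol x_i-\bar{\boldsymbol x}))$, $\hat{\boldsymbol T}(\boldsymbol\gamma)=\frac1n\sum_i g(\boldsymbol\gamma^T(\boldsymbol x_i-\bar{\boldsymbol x}))(\boldsymbol x_i-\bar{\boldsymbol x})$, $\hat{\boldsymbol T}_2(\boldsymbol\gamma)=\hat\nu(\boldsymbol\gamma)\hat{\boldsymbol T}(\boldsymbol\gamma)$. Let $\boldsymbol\Gamma=(\boldsymbol\gamma_1,\dots,\boldsymbol\gamma_p)^T$ satisfy $\boldsymbol\gamma_l^T\hat{\boldsymbol S}\boldsymbol\gamma_j=\mathbf 1\{l=j\}$ for all $j,l$. It is a solution of the deflation-based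 FastICA equations if $\hat{\boldsymbol T}(\boldsymbol\gamma_j)=\hat{\boldsymbol S}\big(\sum_{l\le j}\boldsymbol\gamma_l\boldsymbol\gamma_l^T\big)\hat{\boldsymbol T}(\boldsymbol\gamma_j)$ for all $j$; symmetric FastICA equations if $\boldsymbol\gamma_l^T\hat{\boldsymbol T}(\boldsymbol\gamma_j)\,\mathrm{sign}(\hat\nu(\boldsymbol\gamma_j))=\boldsymbol\gamma_j^T\hat{\boldsymbol T}(\boldsymbol\gamma_l)\,\mathrm{sign}(\hat\nu(\boldsymbol\gamma_l))$ for all $j,l$; squared symmetric FastICA equations if $\boldsymbol\gamma_l^T\hat{\boldsymbol T}_2(\boldsymbol\gamma_j)=\boldsymbol\gamma_j^T\hat{\boldsymbol T}_2(\boldsymbol\gamma_l)$ for all $j,l$. Put $\boldsymbol T_j=\frac1n\sum_i(g(z_{ij})-\mu_j)\boldsymbol z_i$ and $\boldsymbol T_{2j}=\big(\frac1n\sum_iG(z_{ij})\big)\boldsymbol T_j$. Then the following hold, where in each part the estimators $\hat{\boldsymbol\Gamma}=(\hat\gamma_{jl})$ are measurable functions of $\boldsymbol x_1,\dots,\boldsymbol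 x_n$ which, almost surely, solve the respective equations for all sufficiently large $n$ and converge to $\boldsymbol I_p$, and $o_P(1)$ denotes convergence to $0$ in probability as $n\to\infty$. (i) If $\lambda_j\ne\delta_j$ for all $j<p$, there are deflation-based solutions $\hat{\boldsymbol\Gamma}^d$ with $$\sqrt n\,\hat\gamma^d_{jl}=-\sqrt n\,\hat\gamma^d_{lj}-\sqrt n\,\hat S_{jl}+o_P(1)\ (l<j),\qquad \sqrt n(\hat\gamma^d_{jj}-1)=-\tfrac12\sqrt n(\hat S_{jj}-1)+o_P(1),$$ $$\sqrt n\,\hat\gamma^d_{jl}=\frac{\boldsymbol e_l^T\sqrt n\,\boldsymbol T_j-\lambda_j\sqrt n\,\hat S_{jl}}{\lambda_j-\delta_j}+o_P(1)\ (l>j).$$ (ii) If $\nu_j\neq0$ for all $j$, there are symmetric solutions $\hat{\boldsymbol\Gamma}^s$ with $\sqrt n(\hat\gamma^s_{jj}-1)=-\tfrac12\sqrt n(\hat S_{jj}-1)+o_P(1)$ and, for $l\ne j$, $$\sqrt n\,\hat\gamma^s_{jl}=\frac{\boldsymbol e_l^T\sqrt n\,\boldsymbol T_js_j-\boldsymbol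 e_j^T\sqrt n\,\boldsymbol T_ls_l-(\lambda_js_j-\delta_ls_l)\sqrt n\,\hat S_{jl}}{(\lambda_j-\delta_j)s_j+(\lambda_l-\delta_l)s_l}+o_P(1).$$ (iii) There are squared symmetric solutions $\hat{\boldsymbol\Gamma}^{s2}$ with $\sqrt n(\hat\gamma^{s2}_{jj}-1)=-\tfrac12\sqrt n(\hat S_{jj}-1)+o_P(1)$ and, for $l\neq j$, $$\sqrt n\,\hat\gamma^{s2}_{jl}=\frac{\boldsymbol e_l^T\sqrt n\,\boldsymbol T_{2j}-\boldsymbol e_j^T\sqrt n\,\boldsymbol T_{2l}+(\nu_l\delta_l-\nu_j\lambda_j)\sqrt n\,\hat S_{jl}}{\nu_j(\lambda_j-\delta_j)+\nu_l(\lambda_l-\delta_l)}+o_P(1).$$ -/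

import Mathlib

open MeasureTheory ProbabilityTheory Filter Topology Matrix

noncomputable section

namespace FastICA

/-- Admissible functions `G`: twice continuously differentiable, neither linear nor quadratic, and
with `E[G(N)] = 0` for a standard Gaussian variable `N`.  The nonlinearity is `g = deriv G`. -/
structure IsAdmissible (G : ℝ → ℝ) : Prop where
  contDiff : ContDiff ℝ 2 G
  not_quadratic : ¬ ∃ a b c : ℝ, ∀ t, G t = a * t ^ 2 + b * t + c
  integrable_gaussian : Integrable G (gaussianReal 0 1)
  integral_gaussian : ∫ t, G t ∂(gaussianReal 0 1) = 0

section Population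

variable {Ω : Type*} [MeasurableSpace Ω] {p : ℕ}

/-- `x 0, x 1, …` is an i.i.d. sample from the independent component model `x = loc + A z`
with full-rank mixing matrix `A`: `z 0, z 1, …` are i.i.d. copies of a random vector with mutually
independent components. -/
structure IsICSample (P : Measure Ω) (loc : Fin p → ℝ) (A : Matrix (Fin p) (Fin p) ℝ)
    (x z : ℕ → Ω → Fin p → ℝ) : Prop where
  isUnit_det : IsUnit A.det
  model : ∀ i ω, x i ω = loc + A *ᵥ z i ω
  measurable : ∀ i, Measurable (z i)
  indep_sample : iIndepFun z P
  identDistrib : ∀ i, IdentDistrib (z i) (z 0) P P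
  indep_components : iIndepFun (fun (j : Fin p) ω => z 0 ω j) P

/-- (A1): at most one component is Gaussian. -/
def AtMostOneGaussian (P : Measure Ω) (z : Ω → Fin p → ℝ) : Prop :=
  {j : Fin p | ∃ (m : ℝ) (v : NNReal), P.map (fun ω => z ω j) = gaussianReal m v}.Subsingleton

/-- (A2): every component is square integrable with mean `0` and second moment `1`. -/
def IsStandardized (P : Measure Ω) (z : Ω → Fin p → ℝ) : Prop :=
  ∀ j, MemLp (fun ω => z ω j) 2 P ∧ ∫ ω, z ω j ∂P = 0 ∧ ∫ ω, z ω j ^ 2 ∂P = 1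

/-- (A3): the fourth moments and the expected values `ν, μ, σ², λ, δ, τ` exist. -/
structure HasMoments (P : Measure Ω) (G : ℝ → ℝ) (z : Ω → Fin p → ℝ) : Prop where
  beta : ∀ j, Integrable (fun ω => z ω j ^ 4) P
  nu : ∀ j, Integrable (fun ω => G (z ω j)) P
  mu : ∀ j, Integrable (fun ω => deriv G (z ω j)) P
  sigma : ∀ j, Integrable (fun ω => deriv G (z ω j) ^ 2) P
  lam : ∀ j, Integrable (fun ω => deriv G (z ω j) * z ω j) P
  delta : ∀ j, Integrable (fun ω => deriv (deriv G) (z ω j)) P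
  tau : ∀ j, Integrable (fun ω => deriv (deriv G) (z ω j) * z ω j) P

/-- Local domination of the second-order term of the Taylor expansion: for some `ε > 0`, the variable
`(1 + ‖z‖²) sup {|g'(t)| : |t - z_j| ≤ ε (1 + ‖z‖)}` has an integrable upper bound. -/
def IsLocallyDominated (P : Measure Ω) (G : ℝ → ℝ) (z : Ω → Fin p → ℝ) : Prop :=
  ∀ j, ∃ ε > 0, ∃ H : (Fin p → ℝ) → ℝ, Measurable H ∧ Integrable (fun ω => H (z ω)) P ∧
    ∀ y t, |t - y j| ≤ ε * (1 + ‖y‖) → |deriv (deriv G) t| * (1 + ‖y‖ ^ 2) ≤ H y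

/-- `ν_j = E[G(z_j)]` -/
def nu (P : Measure Ω) (G : ℝ → ℝ) (z : Ω → Fin p → ℝ) (j : Fin p) : ℝ :=
  ∫ ω, G (z ω j) ∂P

/-- `μ_j = E[g(z_j)]` -/
def mu (P : Measure Ω) (G : ℝ → ℝ) (z : Ω → Fin p → ℝ) (j : Fin p) : ℝ :=
  ∫ ω, deriv G (z ω j) ∂P

/-- `λ_j = E[g(z_j) z_j]` -/
def lam (P : Measure Ω) (G : ℝ → ℝ) (z : Ω → Fin p → ℝ) (j : Fin p) : ℝ :=
  ∫ ω, deriv G (z ω j) * z ω j ∂P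

/-- `δ_j = E[g'(z_j)]` -/
def del (P : Measure Ω) (G : ℝ → ℝ) (z : Ω → Fin p → ℝ) (j : Fin p) : ℝ :=
  ∫ ω, deriv (deriv G) (z ω j) ∂P

/-- `s_j = sign(ν_j)` -/
def sgn (P : Measure Ω) (G : ℝ → ℝ) (z : Ω → Fin p → ℝ) (j : Fin p) : ℝ :=
  Real.sign (nu P G z j)

end Population

section Sample

variable {n p : ℕ}

/-- The sample mean vector. -/
def sampleMean (X : Fin n → Fin p → ℝ) : Fin p → ℝ :=
  fun k => (n : ℝ)⁻¹ * ∑ i, X i k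

/-- The covariance matrix of the empirical distribution. -/
def sampleCov (X : Fin n → Fin p → ℝ) : Matrix (Fin p) (Fin p) ℝ :=
  Matrix.of fun k l =>
    (n : ℝ)⁻¹ * ∑ i, (X i k - sampleMean X k) * (X i l - sampleMean X l)

/-- The sample average of `G(γᵀ(x_i - x̄))`. -/
def hatG (G : ℝ → ℝ) (X : Fin n → Fin p → ℝ) (γ : Fin p → ℝ) : ℝ :=
  (n : ℝ)⁻¹ * ∑ i, G (γ ⬝ᵥ (X i - sampleMean X))

/-- The sample average of `g(γᵀ(x_i - x̄)) (x_i - x̄)`. -/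
def hatT (G : ℝ → ℝ) (X : Fin n → Fin p → ℝ) (γ : Fin p → ℝ) : Fin p → ℝ :=
  (n : ℝ)⁻¹ • ∑ i, deriv G (γ ⬝ᵥ (X i - sampleMean X)) • (X i - sampleMean X)

/-- The squared-symmetric analogue of `hatT`. -/
def hatT2 (G : ℝ → ℝ) (X : Fin n → Fin p → ℝ) (γ : Fin p → ℝ) : Fin p → ℝ :=
  hatG G X γ • hatT G X γ

/-- `γ_lᵀ Ŝ γ_j = δ_lj`, where `γ_j` is the `j`-th row of `Γ`. -/
def IsWhitening (X : Fin n → Fin p → ℝ) (Γ : Matrix (Fin p) (Fin p) ℝ) : Prop :=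
  ∀ j l, Γ l ⬝ᵥ (sampleCov X *ᵥ Γ j) = if l = j then 1 else 0

/-- Deflation-based FastICA: the estimating equations, together with the constraint under which
the rows are extracted. -/
def IsDeflationSolution (G : ℝ → ℝ) (X : Fin n → Fin p → ℝ)
    (Γ : Matrix (Fin p) (Fin p) ℝ) : Prop :=
  (∀ j, hatT G X (Γ j) =
    sampleCov X *ᵥ ((∑ l ∈ Finset.Iic j, vecMulVec (Γ l) (Γ l)) *ᵥ hatT G X (Γ j))) ∧
  IsWhitening X Γ

/-- Symmetric FastICA: the estimating equations, with the empirical signs. -/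
def IsSymmetricSolution (G : ℝ → ℝ) (X : Fin n → Fin p → ℝ)
    (Γ : Matrix (Fin p) (Fin p) ℝ) : Prop :=
  (∀ j l, (Γ l ⬝ᵥ hatT G X (Γ j)) * Real.sign (hatG G X (Γ j)) =
    (Γ j ⬝ᵥ hatT G X (Γ l)) * Real.sign (hatG G X (Γ l))) ∧
  IsWhitening X Γ

/-- Squared symmetric FastICA: the estimating equations. -/
def IsSquaredSymmetricSolution (G : ℝ → ℝ) (X : Fin n → Fin p → ℝ)
    (Γ : Matrix (Fin p) (Fin p) ℝ) : Prop :=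
  (∀ j l, Γ l ⬝ᵥ hatT2 G X (Γ j) = Γ j ⬝ᵥ hatT2 G X (Γ l)) ∧ IsWhitening X Γ

/-- `T_j = n⁻¹ ∑ (g(z_ij) - μ_j) z_i`, for a source sample `Z` and a number `m` in place of `μ_j`. -/
def srcT (G : ℝ → ℝ) (m : ℝ) (Z : Fin n → Fin p → ℝ) (j : Fin p) : Fin p → ℝ :=
  (n : ℝ)⁻¹ • ∑ i, (deriv G (Z i j) - m) • Z i

/-- `T_{2j} = (n⁻¹ ∑ G(z_ij)) T_j`. -/
def srcT2 (G : ℝ → ℝ) (m : ℝ) (Z : Fin n → Fin p → ℝ) (j : Fin p) : Fin p → ℝ :=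
  ((n : ℝ)⁻¹ * ∑ i, G (Z i j)) • srcT G m Z j

end Sample

section Asymptotics

variable {Ω : Type*} [MeasurableSpace Ω] {p : ℕ}

/-- The first `n` observations of a sequence. -/
def firstObs (x : ℕ → Ω → Fin p → ℝ) (n : ℕ) (ω : Ω) : Fin n → Fin p → ℝ :=
  fun i => x i ω

/-- `R_n = o_P(1)`. -/
def IsLittleOP (P : Measure Ω) (R : ℕ → Ω → ℝ) : Prop :=
  TendstoInMeasure P R atTop (fun _ => 0)

/-- `est` is a sequence of measurable estimators which, almost surely, solves the estimating
equations `Sol` for all large `n` and converges to the identity matrix. -/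
def IsConsistentSolution (P : Measure Ω) (x : ℕ → Ω → Fin p → ℝ)
    (Sol : ∀ n : ℕ, (Fin n → Fin p → ℝ) → Matrix (Fin p) (Fin p) ℝ → Prop)
    (est : ∀ n : ℕ, (Fin n → Fin p → ℝ) → Matrix (Fin p) (Fin p) ℝ) : Prop :=
  (∀ n j l, Measurable fun X => est n X j l) ∧
  ∀ᵐ ω ∂P, (∀ᶠ n in atTop, Sol n (firstObs x n ω) (est n (firstObs x n ω))) ∧
    ∀ j l, Tendsto (fun n => est n (firstObs x n ω) j l) atTop
      (𝓝 ((1 : Matrix (Fin p) (Fin p) ℝ) j l))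

end Asymptotics

end FastICA

end

/-! All three systems have one form. Besides the whitening equations `γ_lᵀ Ŝ γ_j = 1{l = j}`, they
ask that a weighted difference `a_j γ_lᵀ T̂(γ_j) - b_l γ_jᵀ T̂(γ_l)` vanish for `j < l`. The weights
are `a = 1, b = 0` for deflation, the population signs `s_j` for the symmetric version (the
empirical signs agree with them for large `n`), and `ν̂(γ_j)` for the squared version. Near the
identity the first-order change of `γ_lᵀ T̂(γ_j)`, `l ≠ j`, is `λ_j Δ_lj + δ_j Δ_jl`, and that of
the whitening equation is `Δ_lj + Δ_jl`. With `α, β` the limits of the weights, eliminating `Δ_lj`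
leaves `Δ_jl` with coefficient `D_jl = α_j(λ_j - δ_j) + β_l(λ_l - δ_l)`. The hypotheses make this
nonzero, so the system, premultiplied by the inverse of its limiting derivative, has the identity as
derivative.

A uniform law of large numbers makes these derivatives valid almost surely, uniformly over a
neighbourhood as `n → ∞` (`ae_hasUnifStrictFDerivAt_average`). For a fixed realization, simplified
Newton iteration from the identity is then a contraction. Its limit solves the system and equals the
identity minus the premultiplied residual at the identity, up to a negligible error
(`exists_zero_of_hasUnifStrictFDerivAt_id`). Evaluating that residual gives the stated expansions
with error `o(rate)` (`newtonLimit_expansion`), where `rate` adds up absolute values of centred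
averages.

Chebyshev's inequality gives `rate = O_P(n^{-1/2})`, and an almost sure `o(rate)` becomes
`o_P(n^{-1/2})` (`isLittleOP_of_ae_isLittleO`). The estimators are measurable because each Newton
iterate is continuous in the sample and the estimator is a `limsup` of iterates. -/

open Asymptotics

namespace FastICA

/-! ### Strict differentiability along a sequence of maps, and Newton iteration. -/

section UniformStrictDerivative

variable {E F H : Type*} [NormedAddCommGroup E] [NormedSpace ℝ E] [NormedAddCommGroup F]
  [NormedSpace ℝ F] [NormedAddCommGroup H] [NormedSpace ℝ H]

/-- The maps `f n` converge at `x₀` to `c`, and they are strictly differentiable at `x₀` with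
derivative `L` in the limit `n → ∞`: the remainder `f n x - f n y - L (x - y)` is `o(x - y)` as
`n → ∞` and `x, y → x₀` jointly. -/
structure HasUnifStrictFDerivAt (f : ℕ → E → F) (c : F) (L : E →L[ℝ] F) (x₀ : E) : Prop where
  tendsto : Tendsto (fun n => f n x₀) atTop (𝓝 c)
  isLittleO : (fun q : ℕ × E × E => f q.1 q.2.1 - f q.1 q.2.2 - L (q.2.1 - q.2.2))
    =o[atTop ×ˢ 𝓝 (x₀, x₀)] fun q => q.2.1 - q.2.2

namespace HasUnifStrictFDerivAt

variable {f : ℕ → E → F} {c : F} {L : E →L[ℝ] F} {x₀ : E}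

theorem isBigO (h : HasUnifStrictFDerivAt f c L x₀) :
    (fun q : ℕ × E × E => f q.1 q.2.1 - f q.1 q.2.2)
      =O[atTop ×ˢ 𝓝 (x₀, x₀)] fun q => q.2.1 - q.2.2 := by
  have h1 : (fun q : ℕ × E × E => L (q.2.1 - q.2.2)) =O[atTop ×ˢ 𝓝 (x₀, x₀)]
      fun q => q.2.1 - q.2.2 := L.isBigO_comp _ _
  simpa using h.isLittleO.isBigO.add h1

/-- Joint convergence in the index and the argument. -/
theorem tendsto_prod (h : HasUnifStrictFDerivAt f c L x₀) :
    Tendsto (fun q : ℕ × E => f q.1 q.2) (atTop ×ˢ 𝓝 x₀) (𝓝 c) := by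
  have hm : Tendsto (fun q : ℕ × E => (q.1, q.2, x₀)) (atTop ×ˢ 𝓝 x₀)
      (atTop ×ˢ 𝓝 (x₀, x₀)) :=
    tendsto_fst.prodMk (tendsto_snd.prodMk_nhds tendsto_const_nhds)
  have h1 := h.isBigO.comp_tendsto hm
  have h2 : Tendsto (fun q : ℕ × E => q.2 - x₀) (atTop ×ˢ 𝓝 x₀) (𝓝 0) := by
    have : Tendsto (fun q : ℕ × E => q.2) (atTop ×ˢ 𝓝 x₀) (𝓝 x₀) := tendsto_snd
    simpa using this.sub_const x₀
  have h3 := h1.trans_tendsto h2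
  have h4 : Tendsto (fun q : ℕ × E => f q.1 x₀) (atTop ×ˢ 𝓝 x₀) (𝓝 c) :=
    h.tendsto.comp tendsto_fst
  simpa [Function.comp_def] using h3.add h4

theorem tendsto_comp (h : HasUnifStrictFDerivAt f c L x₀) {u : ℕ → E}
    (hu : Tendsto u atTop (𝓝 x₀)) : Tendsto (fun n => f n (u n)) atTop (𝓝 c) :=
  h.tendsto_prod.comp (tendsto_id.prodMk hu)

theorem isLittleO_comp (h : HasUnifStrictFDerivAt f c L x₀) {u v : ℕ → E}
    (hu : Tendsto u atTop (𝓝 x₀)) (hv : Tendsto v atTop (𝓝 x₀)) :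
    (fun n => f n (u n) - f n (v n) - L (u n - v n)) =o[atTop] fun n => u n - v n :=
  h.isLittleO.comp_tendsto (tendsto_id.prodMk (hu.prodMk_nhds hv))

theorem congr_deriv (h : HasUnifStrictFDerivAt f c L x₀) {c' : F} {L' : E →L[ℝ] F} (hc : c = c')
    (hL : ∀ x, L x = L' x) : HasUnifStrictFDerivAt f c' L' x₀ := by
  obtain rfl : L = L' := ContinuousLinearMap.ext hL
  exact hc ▸ h

theorem clm (L : E →L[ℝ] F) (x₀ : E) : HasUnifStrictFDerivAt (fun _ x => L x) (L x₀) L x₀ :=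
  ⟨tendsto_const_nhds, by simp⟩

/-- Random coefficients such as the entries of `Ŝ` enter the calculus this way: only their
convergence is needed, no rate. -/
theorem of_tendsto {u : ℕ → F} (hu : Tendsto u atTop (𝓝 c)) :
    HasUnifStrictFDerivAt (fun n _ => u n) c (0 : E →L[ℝ] F) x₀ :=
  ⟨hu, by simp⟩

theorem add {g : ℕ → E → F} {d : F} {M : E →L[ℝ] F} (hf : HasUnifStrictFDerivAt f c L x₀)
    (hg : HasUnifStrictFDerivAt g d M x₀) :
    HasUnifStrictFDerivAt (fun n x => f n x + g n x) (c + d) (L + M) x₀ := by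
  refine ⟨hf.tendsto.add hg.tendsto, (hf.isLittleO.add hg.isLittleO).congr_left fun q => ?_⟩
  simp only [_root_.add_apply]
  abel

theorem sub {g : ℕ → E → F} {d : F} {M : E →L[ℝ] F} (hf : HasUnifStrictFDerivAt f c L x₀)
    (hg : HasUnifStrictFDerivAt g d M x₀) :
    HasUnifStrictFDerivAt (fun n x => f n x - g n x) (c - d) (L - M) x₀ := by
  refine ⟨hf.tendsto.sub hg.tendsto, (hf.isLittleO.sub hg.isLittleO).congr_left fun q => ?_⟩
  simp only [_root_.sub_apply]
  abel

theorem sum {ι : Type*} {s : Finset ι} {f : ι → ℕ → E → F} {c : ι → F} {L : ι → E →L[ℝ] F}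
    (h : ∀ i ∈ s, HasUnifStrictFDerivAt (f i) (c i) (L i) x₀) :
    HasUnifStrictFDerivAt (fun n x => ∑ i ∈ s, f i n x) (∑ i ∈ s, c i) (∑ i ∈ s, L i) x₀ := by
  refine ⟨tendsto_finsetSum _ fun i hi => (h i hi).tendsto,
    (IsLittleO.sum fun i hi => (h i hi).isLittleO).congr_left fun q => ?_⟩
  simp [Finset.sum_sub_distrib]

theorem const_mul {f : ℕ → E → ℝ} {c : ℝ} {L : E →L[ℝ] ℝ} (h : HasUnifStrictFDerivAt f c L x₀)
    (a : ℝ) : HasUnifStrictFDerivAt (fun n x => a * f n x) (a * c) (a • L) x₀ := by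
  refine ⟨h.tendsto.const_mul a, (h.isLittleO.const_mul_left a).congr_left fun q => ?_⟩
  simp only [_root_.smul_apply, smul_eq_mul]
  ring

theorem mul {f g : ℕ → E → ℝ} {c d : ℝ} {L M : E →L[ℝ] ℝ} (hf : HasUnifStrictFDerivAt f c L x₀)
    (hg : HasUnifStrictFDerivAt g d M x₀) :
    HasUnifStrictFDerivAt (fun n x => f n x * g n x) (c * d) (c • M + d • L) x₀ := by
  refine ⟨hf.tendsto.mul hg.tendsto, ?_⟩
  have m1 : Tendsto (fun q : ℕ × E × E => (q.1, q.2.1)) (atTop ×ˢ 𝓝 (x₀, x₀)) (atTop ×ˢ 𝓝 x₀) :=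
    tendsto_fst.prodMk ((continuous_fst.tendsto (x₀, x₀)).comp tendsto_snd)
  have m2 : Tendsto (fun q : ℕ × E × E => (q.1, q.2.2)) (atTop ×ˢ 𝓝 (x₀, x₀)) (atTop ×ˢ 𝓝 x₀) :=
    tendsto_fst.prodMk ((continuous_snd.tendsto (x₀, x₀)).comp tendsto_snd)
  have f1 : Tendsto (fun q : ℕ × E × E => f q.1 q.2.1 - c) (atTop ×ˢ 𝓝 (x₀, x₀)) (𝓝 0) := by
    simpa using (hf.tendsto_prod.comp m1).sub_const c
  have g1 : Tendsto (fun q : ℕ × E × E => g q.1 q.2.2 - d) (atTop ×ˢ 𝓝 (x₀, x₀)) (𝓝 0) := by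
    simpa using (hg.tendsto_prod.comp m2).sub_const d
  -- The remainder of the product is `(f x - c)(g x - g y) + (g y - d)(f x - f y)` plus `c` and `d`
  -- times the remainders of `g` and `f`. The first two terms are `o(1) · O(x - y)`.
  have e1 := ((isLittleO_one_iff ℝ).2 f1).mul_isBigO hg.isBigO.norm_right
  have e2 := ((isLittleO_one_iff ℝ).2 g1).mul_isBigO hf.isBigO.norm_right
  have e3 := (hg.isLittleO.norm_right.const_mul_left c).add
    (hf.isLittleO.norm_right.const_mul_left d)
  simp only [one_mul] at e1 e2
  refine (((e1.add e2).add e3).of_norm_right).congr_left fun q => ?_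
  simp only [_root_.add_apply, _root_.smul_apply, smul_eq_mul]
  ring

theorem sum_mul {ι : Type*} {s : Finset ι} {f g : ι → ℕ → E → ℝ} {c d : ι → ℝ}
    {L M : ι → E →L[ℝ] ℝ} (hf : ∀ i, HasUnifStrictFDerivAt (f i) (c i) (L i) x₀)
    (hg : ∀ i, HasUnifStrictFDerivAt (g i) (d i) (M i) x₀) :
    HasUnifStrictFDerivAt (fun n x => ∑ i ∈ s, f i n x * g i n x) (∑ i ∈ s, c i * d i)
      (∑ i ∈ s, (c i • M i + d i • L i)) x₀ :=
  sum fun i _ => (hf i).mul (hg i)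

theorem pi {ι : Type*} [Fintype ι] {F : ι → Type*} [∀ i, NormedAddCommGroup (F i)]
    [∀ i, NormedSpace ℝ (F i)] {f : ℕ → E → ∀ i, F i} {c : ∀ i, F i} {L : E →L[ℝ] ∀ i, F i}
    (h : ∀ i, HasUnifStrictFDerivAt (fun n x => f n x i) (c i)
      ((ContinuousLinearMap.proj i).comp L) x₀) : HasUnifStrictFDerivAt f c L x₀ :=
  ⟨tendsto_pi_nhds.2 fun i => (h i).tendsto, isLittleO_pi.2 fun i => (h i).isLittleO⟩

/-- Since `f` is Lipschitz in the joint limit, the remainder of `g`, which is `o(f x - f y)`, is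
also `o(x - y)`. -/
theorem comp {g : ℕ → F → H} {d : H} {M : F →L[ℝ] H} (hg : HasUnifStrictFDerivAt g d M c)
    (hf : HasUnifStrictFDerivAt f c L x₀) :
    HasUnifStrictFDerivAt (fun n x => g n (f n x)) d (M.comp L) x₀ := by
  refine ⟨hg.tendsto_comp hf.tendsto, ?_⟩
  have m1 : Tendsto (fun q : ℕ × E × E => (q.1, q.2.1)) (atTop ×ˢ 𝓝 (x₀, x₀)) (atTop ×ˢ 𝓝 x₀) :=
    tendsto_fst.prodMk ((continuous_fst.tendsto (x₀, x₀)).comp tendsto_snd)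
  have m2 : Tendsto (fun q : ℕ × E × E => (q.1, q.2.2)) (atTop ×ˢ 𝓝 (x₀, x₀)) (atTop ×ˢ 𝓝 x₀) :=
    tendsto_fst.prodMk ((continuous_snd.tendsto (x₀, x₀)).comp tendsto_snd)
  have m : Tendsto (fun q : ℕ × E × E => (q.1, f q.1 q.2.1, f q.1 q.2.2))
      (atTop ×ˢ 𝓝 (x₀, x₀)) (atTop ×ˢ 𝓝 (c, c)) :=
    tendsto_fst.prodMk ((hf.tendsto_prod.comp m1).prodMk_nhds (hf.tendsto_prod.comp m2))
  have e1 := (hg.isLittleO.comp_tendsto m).trans_isBigO hf.isBigO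
  have e2 := (M.isBigO_comp (fun q : ℕ × E × E =>
    f q.1 q.2.1 - f q.1 q.2.2 - L (q.2.1 - q.2.2)) (atTop ×ˢ 𝓝 (x₀, x₀))).trans_isLittleO
      hf.isLittleO
  refine (e1.add e2).congr_left fun q => ?_
  simp only [Function.comp_apply, ContinuousLinearMap.comp_apply, map_sub]
  abel

end HasUnifStrictFDerivAt

/-- Simplified Newton iteration for a sequence of maps whose limiting derivative at `x₀` is the
identity and whose values at `x₀` tend to `0`. -/
theorem exists_zero_of_hasUnifStrictFDerivAt_id [CompleteSpace E] {f : ℕ → E → E} {x₀ : E}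
    (h : HasUnifStrictFDerivAt f 0 (ContinuousLinearMap.id ℝ E) x₀) :
    ∃ y : ℕ → E, (∀ᶠ n in atTop, f n (y n) = 0 ∧
        Tendsto (fun k => (fun x => x - f n x)^[k] x₀) atTop (𝓝 (y n))) ∧
      Tendsto y atTop (𝓝 x₀) ∧
      (fun n => y n - x₀ + f n x₀) =o[atTop] fun n => f n x₀ := by
  -- The remainder of `f n` is, up to sign, the increment of `x ↦ x - f n x`, so this bound says
  -- that the Newton step contracts by `1/2`.
  have h1 := h.isLittleO.def (c := 1 / 2) (by norm_num)
  obtain ⟨A, hA, B, hB, hAB⟩ := eventually_prod_iff.1 h1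
  obtain ⟨r, hr, hrB⟩ := Metric.eventually_nhds_iff_ball.1 hB
  -- On the closed ball of radius `r / 2` a step ends within `r / 4 + ‖f n x₀‖` of `x₀`; the bound
  -- `r / 4` keeps the ball invariant.
  have h2 : ∀ᶠ n in atTop, ‖f n x₀‖ < r / 4 := by
    have := h.tendsto.norm
    rw [norm_zero] at this
    exact this.eventually_lt_const (by positivity)
  have key : ∀ᶠ n in atTop, ∃ y : E, f n y = 0 ∧
      Tendsto (fun k => (fun x => x - f n x)^[k] x₀) atTop (𝓝 y) ∧ ‖y - x₀‖ ≤ 2 * ‖f n x₀‖ := by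
    filter_upwards [hA, h2] with n hn hn2
    set K : E → E := fun x => x - f n x with hK
    set s := Metric.closedBall x₀ (r / 2) with hs
    have hlip : ∀ x ∈ s, ∀ y ∈ s, ‖K x - K y‖ ≤ 1 / 2 * ‖x - y‖ := by
      intro x hx y hy
      have hmem : (x, y) ∈ Metric.ball (x₀, x₀) r := by
        rw [← ball_prod_same]
        exact ⟨Metric.closedBall_subset_ball (by linarith) hx,
          Metric.closedBall_subset_ball (by linarith) hy⟩
      have := hAB hn (hrB _ hmem)
      simp only [ContinuousLinearMap.id_apply] at this
      have e : K x - K y = -(f n x - f n y - (x - y)) := by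
        change x - f n x - (y - f n y) = _
        abel
      rw [e, norm_neg]
      exact this
    have hx0 : x₀ ∈ s := Metric.mem_closedBall_self (by positivity)
    have hself : ∀ x ∈ s, ‖x - x₀‖ ≤ r / 2 := fun x hx => by
      simpa [hs, dist_eq_norm] using hx
    have hstep : ∀ x ∈ s, ‖K x - x₀‖ ≤ 1 / 2 * ‖x - x₀‖ + ‖f n x₀‖ := by
      intro x hx
      have e : K x - x₀ = (K x - K x₀) - f n x₀ := by
        change x - f n x - x₀ = x - f n x - (x₀ - f n x₀) - f n x₀
        abel
      rw [e]
      exact (norm_sub_le _ _).trans (by gcongr; exact hlip x hx x₀ hx0)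
    have hmaps : Set.MapsTo K s s := by
      intro x hx
      rw [hs, Metric.mem_closedBall, dist_eq_norm]
      have := hstep x hx
      have := hself x hx
      linarith
    have hcon : ContractingWith (1 / 2) (hmaps.restrict K s s) := by
      refine ⟨by rw [← NNReal.coe_lt_coe]; norm_num, LipschitzWith.of_dist_le_mul ?_⟩
      intro x y
      have := hlip x x.2 y y.2
      simpa [Subtype.dist_eq, dist_eq_norm] using this
    obtain ⟨y, hys, hfix, hlim, -⟩ := hcon.exists_fixedPoint'
      (Metric.isClosed_closedBall.isComplete) hmaps hx0 (edist_ne_top _ _)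
    have hKy : K y = y := hfix
    refine ⟨y, by simpa [hK] using hKy, hlim, ?_⟩
    have := hstep y hys
    rw [hKy] at this
    linarith
  choose! y hy using fun n (hn : ∃ y : E, f n y = 0 ∧
      Tendsto (fun k => (fun x => x - f n x)^[k] x₀) atTop (𝓝 y) ∧ ‖y - x₀‖ ≤ 2 * ‖f n x₀‖) => hn
  have hO : (fun n => y n - x₀) =O[atTop] fun n => f n x₀ := by
    refine IsBigO.of_bound 2 ?_
    filter_upwards [key] with n hn using (hy n hn).2.2
  have hlim : Tendsto y atTop (𝓝 x₀) := by
    rw [← tendsto_sub_nhds_zero_iff]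
    exact hO.trans_tendsto h.tendsto
  refine ⟨y, ?_, hlim, ?_⟩
  · filter_upwards [key] with n hn using ⟨(hy n hn).1, (hy n hn).2.1⟩
  -- Strict differentiability at the pair `(y n, x₀)`, with `f n (y n) = 0`, is the claimed
  -- expansion up to sign.
  · have := ((h.isLittleO_comp hlim tendsto_const_nhds).trans_isBigO hO).neg_left
    refine this.congr' ?_ EventuallyEq.rfl
    filter_upwards [key] with n hn
    simp only [(hy n hn).1, ContinuousLinearMap.id_apply]
    abel

end UniformStrictDerivative

/-! ### Uniform strong law, root-`n` boundedness, and passage to `o_P`. -/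

section LargeNumbers

open scoped ENNReal

variable {Ω Y : Type*} [MeasurableSpace Ω] {P : Measure Ω} [MeasurableSpace Y] {z : ℕ → Ω → Y}

theorem ae_tendsto_average {E : Type*} [NormedAddCommGroup E] [NormedSpace ℝ E] [CompleteSpace E]
    [MeasurableSpace E] [BorelSpace E] (hindep : iIndepFun z P)
    (hid : ∀ i, IdentDistrib (z i) (z 0) P P) {φ : Y → E} (hφ : Measurable φ)
    (hint : Integrable (fun ω => φ (z 0 ω)) P) :
    ∀ᵐ ω ∂P, Tendsto (fun n : ℕ => (n : ℝ)⁻¹ • ∑ i ∈ Finset.range n, φ (z i ω)) atTop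
      (𝓝 (∫ ω, φ (z 0 ω) ∂P)) :=
  strong_law_ae (fun i ω => φ (z i ω)) hint
    (fun _ _ hij => (hindep.indepFun hij).comp hφ hφ) fun i => (hid i).comp hφ

set_option maxHeartbeats 1000000 in
/-- Uniform law of large numbers for a parametric family whose derivative in the parameter is
jointly continuous and dominated near `θ₀` by an integrable function. -/
theorem ae_hasUnifStrictFDerivAt_average [TopologicalSpace Y]
    [TopologicalSpace.PseudoMetrizableSpace Y] [BorelSpace Y] [SecondCountableTopology Y] {Θ : Type*}
    [NormedAddCommGroup Θ] [NormedSpace ℝ Θ] [ProperSpace Θ]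
    (hz : Measurable (z 0)) (hindep : iIndepFun z P)
    (hid : ∀ i, IdentDistrib (z i) (z 0) P P) {F : Θ → Y → ℝ} {F' : Θ → Y → Θ →L[ℝ] ℝ} {θ₀ : Θ}
    {R : ℝ} (hR : 0 < R) (hF : ∀ θ y, HasFDerivAt (fun θ => F θ y) (F' θ y) θ)
    (hF' : Continuous fun q : Y × Θ => F' q.2 q.1) (hm : Measurable (F θ₀))
    (hint : Integrable (fun ω => F θ₀ (z 0 ω)) P) {H : Y → ℝ}
    (hH : Integrable (fun ω => H (z 0 ω)) P)
    (hdom : ∀ y, ∀ θ ∈ Metric.closedBall θ₀ R, ‖F' θ y‖ ≤ H y) :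
    Integrable (fun ω => F' θ₀ (z 0 ω)) P ∧ ∀ᵐ ω ∂P, HasUnifStrictFDerivAt
      (fun (n : ℕ) θ => (n : ℝ)⁻¹ * ∑ i ∈ Finset.range n, F θ (z i ω))
      (∫ ω, F θ₀ (z 0 ω) ∂P) (∫ ω, F' θ₀ (z 0 ω) ∂P) θ₀ := by
  have hF'c : Continuous (F' θ₀) := hF'.comp (by fun_prop : Continuous fun y : Y => (y, θ₀))
  have hF'int : Integrable (fun ω => F' θ₀ (z 0 ω)) P :=
    hH.mono' (hF'c.comp_stronglyMeasurable hz.stronglyMeasurable).aestronglyMeasurable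
      (ae_of_all _ fun ω => hdom _ _ (Metric.mem_closedBall_self hR.le))
  refine ⟨hF'int, ?_⟩
  set K : ℕ → Set Θ := fun m => Metric.closedBall θ₀ (R / (m + 1)) with hKdef
  have hKpos : ∀ m : ℕ, 0 < R / (m + 1) := fun m => by positivity
  have hK : ∀ m, IsCompact (K m) := fun m => isCompact_closedBall _ _
  have h0K : ∀ m, θ₀ ∈ K m := fun m => Metric.mem_closedBall_self (hKpos m).le
  have hKR : ∀ m, K m ⊆ Metric.closedBall θ₀ R := fun m =>
    Metric.closedBall_subset_closedBall (div_le_self hR.le (by linarith [(m.cast_nonneg : (0:ℝ) ≤ m)]))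
  let d : Y → Θ → ℝ := fun y θ => ‖F' θ y - F' θ₀ y‖
  have hd : Continuous ↿d := by
    change Continuous fun q : Y × Θ => ‖F' q.2 q.1 - F' θ₀ q.1‖
    exact (hF'.sub (hF'c.comp continuous_fst)).norm
  -- The oscillation of the derivative over balls shrinking to `θ₀`. By dominated convergence its
  -- mean tends to `0`, and by the law of large numbers its sample average is eventually small.
  let osc : ℕ → Y → ℝ := fun m y => sSup (d y '' K m)
  have hoscc : ∀ m, Continuous (osc m) := fun m => (hK m).continuous_sSup hd
  have hdy : ∀ y, Continuous (d y) := fun y => hd.comp (by fun_prop : Continuous fun θ => (y, θ))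
  have hle : ∀ m y, ∀ θ ∈ K m, d y θ ≤ osc m y := fun m y θ hθ =>
    le_csSup ((hK m).image (hdy y)).bddAbove (Set.mem_image_of_mem _ hθ)
  have hosc0 : ∀ m y, 0 ≤ osc m y := fun m y => (norm_nonneg _).trans (hle m y θ₀ (h0K m))
  have hosc2 : ∀ m y, osc m y ≤ 2 * H y := by
    intro m y
    refine csSup_le ((Set.nonempty_of_mem (h0K m)).image _) ?_
    rintro _ ⟨θ, hθ, rfl⟩
    have h1 := hdom y θ (hKR m hθ)
    have h2 := hdom y θ₀ (hKR m (h0K m))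
    have := norm_sub_le (F' θ y) (F' θ₀ y)
    change ‖F' θ y - F' θ₀ y‖ ≤ _
    linarith
  have hosclim : ∀ y, Tendsto (fun m => osc m y) atTop (𝓝 0) := by
    intro y
    rw [Metric.tendsto_atTop]
    intro ε hε
    have h1 : Tendsto (d y) (𝓝 θ₀) (𝓝 0) := by
      have := (hdy y).tendsto θ₀
      simpa [d] using this
    obtain ⟨r, hr, hrε⟩ := Metric.eventually_nhds_iff_ball.1
      (h1.eventually_lt_const (half_pos hε))
    have h2 : Tendsto (fun m : ℕ => R / ((m : ℝ) + 1)) atTop (𝓝 0) :=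
      tendsto_const_nhds.div_atTop (tendsto_natCast_atTop_atTop.atTop_add tendsto_const_nhds)
    obtain ⟨N, hN⟩ := eventually_atTop.1 (h2.eventually_lt_const hr)
    refine ⟨N, fun m hm => ?_⟩
    have : osc m y ≤ ε / 2 := by
      refine csSup_le ((Set.nonempty_of_mem (h0K m)).image _) ?_
      rintro _ ⟨θ, hθ, rfl⟩
      exact (hrε θ (Metric.closedBall_subset_ball (hN m hm) hθ)).le
    rw [Real.dist_eq, sub_zero, abs_of_nonneg (hosc0 m y)]
    linarith
  have hoscm : ∀ m, AEStronglyMeasurable (fun ω => osc m (z 0 ω)) P := fun m =>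
    ((hoscc m).measurable.comp hz).aestronglyMeasurable
  have hoscb : ∀ m ω, ‖osc m (z 0 ω)‖ ≤ 2 * H (z 0 ω) := fun m ω => by
    rw [Real.norm_of_nonneg (hosc0 _ _)]; exact hosc2 _ _
  have hoscint : ∀ m, Integrable (fun ω => osc m (z 0 ω)) P := fun m =>
    (hH.const_mul 2).mono' (hoscm m) (ae_of_all _ (hoscb m))
  have hI : Tendsto (fun m => ∫ ω, osc m (z 0 ω) ∂P) atTop (𝓝 0) := by
    have := tendsto_integral_of_dominated_convergence (μ := P) (fun ω => 2 * H (z 0 ω)) hoscm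
      (hH.const_mul 2) (fun m => ae_of_all _ (hoscb m))
      (ae_of_all _ fun ω => hosclim (z 0 ω))
    simpa using this
  have hA := ae_tendsto_average hindep hid hm hint
  have hB := ae_tendsto_average hindep hid hF'c.measurable hF'int
  -- The radii form a sequence, so one null set serves all of them.
  have hC : ∀ᵐ ω ∂P, ∀ m, Tendsto
      (fun n : ℕ => (n : ℝ)⁻¹ • ∑ i ∈ Finset.range n, osc m (z i ω)) atTop
      (𝓝 (∫ ω, osc m (z 0 ω) ∂P)) :=
    ae_all_iff.2 fun m => ae_tendsto_average hindep hid (hoscc m).measurable (hoscint m)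
  filter_upwards [hA, hB, hC] with ω hAω hBω hCω
  refine ⟨by simpa using hAω, ?_⟩
  set L := ∫ ω, F' θ₀ (z 0 ω) ∂P with hL
  refine IsLittleO.of_bound fun ε hε => ?_
  obtain ⟨m, hm⟩ := (hI.eventually_lt_const (half_pos hε)).exists
  have e1 := (hCω m).eventually_lt_const hm
  have e2 : ∀ᶠ n : ℕ in atTop,
      ‖(n : ℝ)⁻¹ • ∑ i ∈ Finset.range n, F' θ₀ (z i ω) - L‖ < ε / 2 := by
    have : Tendsto (fun n : ℕ => ‖(n : ℝ)⁻¹ • ∑ i ∈ Finset.range n, F' θ₀ (z i ω) - L‖) atTop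
        (𝓝 0) := by simpa using (hBω.sub_const L).norm
    exact this.eventually_lt_const (half_pos hε)
  have e3 : ∀ᶠ q : Θ × Θ in 𝓝 (θ₀, θ₀), q.1 ∈ K m ∧ q.2 ∈ K m := by
    have e : ∀ᶠ θ in 𝓝 θ₀, θ ∈ K m := Metric.closedBall_mem_nhds _ (hKpos m)
    rw [nhds_prod_eq]
    exact e.prod_mk e
  filter_upwards [(e1.and e2).prod_mk e3]
  rintro ⟨n, a, b⟩ ⟨⟨h1, h2⟩, ha, hb⟩
  simp only at h1 h2 ha hb ⊢
  -- Mean value inequality on the convex ball `K m`, applied to `F` minus its linearization at `θ₀`.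
  have hpt : ∀ y, ‖F a y - F b y - F' θ₀ y (a - b)‖ ≤ osc m y * ‖a - b‖ := fun y =>
    Convex.norm_image_sub_le_of_norm_hasFDerivWithin_le' (f := fun θ => F θ y)
      (f' := fun θ => F' θ y) (fun θ _ => (hF θ y).hasFDerivWithinAt) (fun θ hθ => hle m y θ hθ)
      (convex_closedBall _ _) hb ha
  have hn : (0 : ℝ) ≤ (n : ℝ)⁻¹ := by positivity
  set A := (n : ℝ)⁻¹ • ∑ i ∈ Finset.range n, F' θ₀ (z i ω) with hAdef
  have split : (n : ℝ)⁻¹ * ∑ i ∈ Finset.range n, F a (z i ω) -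
      (n : ℝ)⁻¹ * ∑ i ∈ Finset.range n, F b (z i ω) - L (a - b) =
      (n : ℝ)⁻¹ * ∑ i ∈ Finset.range n, (F a (z i ω) - F b (z i ω) - F' θ₀ (z i ω) (a - b)) +
        (A - L) (a - b) := by
    simp only [hAdef, _root_.sub_apply, _root_.smul_apply,
      _root_.sum_apply, Finset.sum_sub_distrib, smul_eq_mul]
    ring
  rw [split]
  have b1 : ‖(n : ℝ)⁻¹ * ∑ i ∈ Finset.range n,
      (F a (z i ω) - F b (z i ω) - F' θ₀ (z i ω) (a - b))‖ ≤ ε / 2 * ‖a - b‖ := by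
    rw [norm_mul, Real.norm_of_nonneg hn]
    calc _ ≤ (n : ℝ)⁻¹ * ∑ i ∈ Finset.range n, osc m (z i ω) * ‖a - b‖ := by
          gcongr
          exact norm_sum_le_of_le _ fun i _ => hpt _
      _ = ((n : ℝ)⁻¹ * ∑ i ∈ Finset.range n, osc m (z i ω)) * ‖a - b‖ := by
          rw [← Finset.sum_mul, mul_assoc]
      _ ≤ _ := by
          gcongr
          exact h1.le
  have b2 : ‖(A - L) (a - b)‖ ≤ ε / 2 * ‖a - b‖ :=
    ((A - L).le_opNorm _).trans (by gcongr)
  calc _ ≤ _ := norm_add_le _ _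
    _ ≤ ε / 2 * ‖a - b‖ + ε / 2 * ‖a - b‖ := add_le_add b1 b2
    _ = ε * ‖a - b‖ := by ring

/-- `b n = O_P(n^{-1/2})`, uniformly in `n`. -/
def IsRootBounded (P : Measure Ω) (b : ℕ → Ω → ℝ) : Prop :=
  ∀ ε : ℝ≥0∞, ε ≠ 0 → ∃ M : ℝ, 0 < M ∧ ∀ n : ℕ, P {ω | M ≤ √n * |b n ω|} ≤ ε

theorem IsRootBounded.abs {b : ℕ → Ω → ℝ} (h : IsRootBounded P b) :
    IsRootBounded P fun n ω => |b n ω| := by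
  simpa [IsRootBounded] using h

theorem IsRootBounded.add {b b' : ℕ → Ω → ℝ} (h : IsRootBounded P b) (h' : IsRootBounded P b') :
    IsRootBounded P fun n ω => b n ω + b' n ω := by
  intro ε hε
  obtain ⟨M, hM, hb⟩ := h (ε / 2) (ENNReal.half_pos hε).ne'
  obtain ⟨M', hM', hb'⟩ := h' (ε / 2) (ENNReal.half_pos hε).ne'
  refine ⟨M + M', by positivity, fun n => ?_⟩
  calc P {ω | M + M' ≤ √n * |b n ω + b' n ω|}
      ≤ P ({ω | M ≤ √n * |b n ω|} ∪ {ω | M' ≤ √n * |b' n ω|}) := by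
        refine measure_mono fun ω hω => ?_
        by_contra hcon
        simp only [Set.mem_union, Set.mem_ofPred_eq, not_or, not_le] at hcon hω
        have := mul_le_mul_of_nonneg_left (abs_add_le (b n ω) (b' n ω)) (Real.sqrt_nonneg n)
        linarith [hcon.1, hcon.2]
    _ ≤ P {ω | M ≤ √n * |b n ω|} + P {ω | M' ≤ √n * |b' n ω|} := measure_union_le _ _
    _ ≤ ε / 2 + ε / 2 := add_le_add (hb n) (hb' n)
    _ = ε := ENNReal.add_halves ε

theorem IsRootBounded.sum {ι : Type*} {s : Finset ι} {b : ι → ℕ → Ω → ℝ}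
    (h : ∀ i ∈ s, IsRootBounded P (b i)) : IsRootBounded P fun n ω => ∑ i ∈ s, b i n ω := by
  classical
  induction s using Finset.induction_on with
  | empty => exact fun ε _ => ⟨1, one_pos, fun n => by simp [not_le.2 one_pos]⟩
  | insert i s hi ih =>
    simp only [Finset.sum_insert hi]
    exact (h i (Finset.mem_insert_self _ _)).add
      (ih fun k hk => h k (Finset.mem_insert_of_mem hk))

/-- Chebyshev's inequality: for `n ≥ 1` the average multiplied by `√n` has the variance of a single
term, and for `n = 0` it vanishes. -/
theorem isRootBounded_average [IsProbabilityMeasure P] (hindep : iIndepFun z P)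
    (hid : ∀ i, IdentDistrib (z i) (z 0) P P) {φ : Y → ℝ} (hφ : Measurable φ)
    (hL2 : MemLp (fun ω => φ (z 0 ω)) 2 P) (hmean : ∫ ω, φ (z 0 ω) ∂P = 0) :
    IsRootBounded P fun n ω => (n : ℝ)⁻¹ * ∑ i ∈ Finset.range n, φ (z i ω) := by
  have hidφ : ∀ i, IdentDistrib (fun ω => φ (z i ω)) (fun ω => φ (z 0 ω)) P P :=
    fun i => (hid i).comp hφ
  have hLi : ∀ i, MemLp (fun ω => φ (z i ω)) 2 P := fun i => (hidφ i).memLp_iff.2 hL2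
  have hmi : ∀ i, ∫ ω, φ (z i ω) ∂P = 0 := fun i => (hidφ i).integral_eq.trans hmean
  set V := variance (fun ω => φ (z 0 ω)) P with hV
  have hV0 : 0 ≤ V := variance_nonneg _ _
  intro ε hε
  have hlim : Tendsto (fun M : ℝ => ENNReal.ofReal (V / M ^ 2)) atTop (𝓝 0) := by
    have : Tendsto (fun M : ℝ => V / M ^ 2) atTop (𝓝 0) :=
      tendsto_const_nhds.div_atTop (tendsto_pow_atTop two_ne_zero)
    simpa using ENNReal.tendsto_ofReal this
  obtain ⟨M, hMε, hM⟩ := ((hlim.eventually_lt_const hε.bot_lt).and (eventually_gt_atTop 0)).exists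
  refine ⟨M, hM, fun n => ?_⟩
  set X : Ω → ℝ := fun ω => (√n * (n : ℝ)⁻¹) * (∑ i ∈ Finset.range n, fun ω => φ (z i ω)) ω with hX
  have hS : MemLp (∑ i ∈ Finset.range n, fun ω => φ (z i ω)) 2 P :=
    memLp_finsetSum' _ fun i _ => hLi i
  have hXL : MemLp X 2 P := hS.const_mul _
  have hXmean : ∫ ω, X ω ∂P = 0 := by
    simp only [hX, integral_const_mul, Finset.sum_apply]
    rw [integral_finsetSum _ fun i _ => (hLi i).integrable one_le_two]
    simp [hmi]
  have hXvar : variance X P ≤ V := by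
    have h1 : variance X P = (√n * (n : ℝ)⁻¹) ^ 2 * (n * V) := by
      rw [hX, variance_const_mul, IndepFun.variance_sum (fun i _ => hLi i)
        (fun i _ j _ hij => (hindep.indepFun hij).comp hφ hφ)]
      congr 1
      rw [Finset.sum_congr rfl fun i _ => (hidφ i).variance_eq]
      simp [hV]
    rw [h1, mul_pow, Real.sq_sqrt n.cast_nonneg]
    rcases Nat.eq_zero_or_pos n with rfl | hn
    · simpa using hV0
    · have : (n : ℝ) ≠ 0 := by positivity
      apply le_of_eq
      field_simp
  calc P {ω | M ≤ √n * |(n : ℝ)⁻¹ * ∑ i ∈ Finset.range n, φ (z i ω)|}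
      = P {ω | M ≤ |X ω - ∫ ω, X ω ∂P|} := by
        rw [hXmean]
        congr 1
        ext ω
        simp only [Set.mem_ofPred_eq, sub_zero, hX, Finset.sum_apply, mul_assoc]
        rw [abs_mul (√(n : ℝ)), abs_of_nonneg (Real.sqrt_nonneg (n : ℝ))]
    _ ≤ ENNReal.ofReal (variance X P / M ^ 2) := meas_ge_le_variance_div_sq hXL hM
    _ ≤ ENNReal.ofReal (V / M ^ 2) := by gcongr
    _ ≤ ε := hMε.le

/-- The quotient of `√n R` by `1 + √n |b|` tends to `0` almost surely, hence in probability, and the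
denominator is bounded in probability. The summand `1` keeps the quotient meaningful where `b`
vanishes. -/
theorem isLittleOP_of_ae_isLittleO [IsProbabilityMeasure P] {R b : ℕ → Ω → ℝ}
    (hR : ∀ n, Measurable (R n))
    (hb : ∀ n, Measurable (b n)) (h : ∀ᵐ ω ∂P, (fun n => R n ω) =o[atTop] fun n => b n ω)
    (hB : IsRootBounded P b) : IsLittleOP P fun n ω => √n * R n ω := by
  let Q : ℕ → Ω → ℝ := fun n ω => √n * R n ω / (1 + √n * |b n ω|)
  have hpos : ∀ (n : ℕ) ω, 0 < 1 + √n * |b n ω| := fun n ω => by positivity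
  have hQm : ∀ n, Measurable (Q n) := fun n =>
    ((hR n).const_mul _).div ((((hb n).abs).const_mul _).const_add _)
  have hQ : TendstoInMeasure P Q atTop fun _ => 0 := by
    refine tendstoInMeasure_of_tendsto_ae (fun n => (hQm n).aestronglyMeasurable) ?_
    filter_upwards [h] with ω hω
    have h1 : (fun n : ℕ => √n * R n ω) =o[atTop] fun n => 1 + √n * |b n ω| := by
      refine ((isBigO_refl (fun n : ℕ => √(n : ℝ)) atTop).mul_isLittleO hω).trans_isBigO
        (IsBigO.of_bound 1 (Eventually.of_forall fun n => ?_))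
      rw [norm_mul, Real.norm_of_nonneg (Real.sqrt_nonneg _), Real.norm_of_nonneg (hpos n ω).le,
        Real.norm_eq_abs]
      linarith
    exact h1.tendsto_div_nhds_zero
  rw [tendstoInMeasure_iff_norm] at hQ
  rw [IsLittleOP, tendstoInMeasure_iff_norm]
  intro ε hε
  rw [ENNReal.tendsto_nhds_zero]
  intro η hη
  obtain ⟨M, hM, hMb⟩ := hB (η / 2) (ENNReal.half_pos hη.ne').ne'
  have hη2 := ENNReal.tendsto_nhds_zero.1 (hQ (ε / (1 + M)) (by positivity)) (η / 2)
    (ENNReal.half_pos hη.ne')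
  filter_upwards [hη2] with n hn
  calc P {ω | ε ≤ ‖√n * R n ω - 0‖}
      ≤ P ({ω | ε / (1 + M) ≤ ‖Q n ω - 0‖} ∪ {ω | M ≤ √n * |b n ω|}) := by
        refine measure_mono fun ω hω => ?_
        by_contra hcon
        simp only [Set.mem_union, Set.mem_ofPred_eq, not_or, not_le, sub_zero] at hcon hω
        obtain ⟨h1, h2⟩ := hcon
        have h3 : ‖Q n ω‖ * (1 + √n * |b n ω|) = ‖√n * R n ω‖ := by
          rw [norm_div, Real.norm_of_nonneg (hpos n ω).le, div_mul_cancel₀ _ (hpos n ω).ne']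
        rw [lt_div_iff₀ (by positivity)] at h1
        have h4 : ‖Q n ω‖ * (1 + √n * |b n ω|) ≤ ‖Q n ω‖ * (1 + M) := by gcongr
        linarith
    _ ≤ _ := measure_union_le _ _
    _ ≤ η / 2 + η / 2 := add_le_add hn (hMb n)
    _ = η := ENNReal.add_halves η

end LargeNumbers

/-! ### Averages as functions of a direction and a centre, and the derivative of the projection. -/

section EmpiricalAverages

variable {p : ℕ}

/-- The average of `g(uᵀ(y_i - m)) (y_{il} - m_l)` at `θ = (u, m)`. -/
noncomputable def avgT (G : ℝ → ℝ) (y : ℕ → Fin p → ℝ) (l : Fin p) (n : ℕ)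
    (θ : (Fin p → ℝ) × (Fin p → ℝ)) : ℝ :=
  (n : ℝ)⁻¹ * ∑ i ∈ Finset.range n, deriv G (θ.1 ⬝ᵥ (y i - θ.2)) * (y i l - θ.2 l)

/-- The average of `G(uᵀ(y_i - m))` at `θ = (u, m)`. -/
noncomputable def avgG (G : ℝ → ℝ) (y : ℕ → Fin p → ℝ) (n : ℕ)
    (θ : (Fin p → ℝ) × (Fin p → ℝ)) : ℝ :=
  (n : ℝ)⁻¹ * ∑ i ∈ Finset.range n, G (θ.1 ⬝ᵥ (y i - θ.2))

/-- The derivative of `(u, m) ↦ uᵀ(y - m)`. -/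
noncomputable def projDeriv (θ : (Fin p → ℝ) × (Fin p → ℝ)) (y : Fin p → ℝ) :
    ((Fin p → ℝ) × (Fin p → ℝ)) →L[ℝ] ℝ :=
  ∑ k, ((y k - θ.2 k) • (ContinuousLinearMap.proj (R := ℝ) (φ := fun _ : Fin p => ℝ) k).comp
      (ContinuousLinearMap.fst ℝ (Fin p → ℝ) (Fin p → ℝ)) -
    θ.1 k • (ContinuousLinearMap.proj (R := ℝ) (φ := fun _ : Fin p => ℝ) k).comp
      (ContinuousLinearMap.snd ℝ (Fin p → ℝ) (Fin p → ℝ)))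

theorem projDeriv_apply (θ h : (Fin p → ℝ) × (Fin p → ℝ)) (y : Fin p → ℝ) :
    projDeriv θ y h = ∑ k, ((y k - θ.2 k) * h.1 k - θ.1 k * h.2 k) := by
  simp [projDeriv, _root_.sum_apply]

theorem hasFDerivAt_dotProduct_sub (θ : (Fin p → ℝ) × (Fin p → ℝ)) (y : Fin p → ℝ) :
    HasFDerivAt (fun θ : (Fin p → ℝ) × (Fin p → ℝ) => θ.1 ⬝ᵥ (y - θ.2)) (projDeriv θ y) θ := by
  simp only [dotProduct, projDeriv]
  refine HasFDerivAt.fun_sum fun k _ => ?_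
  have h1 : HasFDerivAt (fun θ : (Fin p → ℝ) × (Fin p → ℝ) => θ.1 k)
      ((ContinuousLinearMap.proj (R := ℝ) (φ := fun _ : Fin p => ℝ) k).comp
      (ContinuousLinearMap.fst ℝ (Fin p → ℝ) (Fin p → ℝ))) θ :=
    ((ContinuousLinearMap.proj (R := ℝ) (φ := fun _ : Fin p => ℝ) k).comp
      (ContinuousLinearMap.fst ℝ (Fin p → ℝ) (Fin p → ℝ))).hasFDerivAt
  have h2 : HasFDerivAt (fun θ : (Fin p → ℝ) × (Fin p → ℝ) => θ.2 k)
      ((ContinuousLinearMap.proj (R := ℝ) (φ := fun _ : Fin p => ℝ) k).comp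
      (ContinuousLinearMap.snd ℝ (Fin p → ℝ) (Fin p → ℝ))) θ :=
    ((ContinuousLinearMap.proj (R := ℝ) (φ := fun _ : Fin p => ℝ) k).comp
      (ContinuousLinearMap.snd ℝ (Fin p → ℝ) (Fin p → ℝ))).hasFDerivAt
  refine (h1.mul (h2.const_sub (y k))).congr_fderiv ?_
  ext v <;> simp

theorem continuous_projDeriv : Continuous fun q : (Fin p → ℝ) × (Fin p → ℝ) × (Fin p → ℝ) =>
    projDeriv q.2 q.1 := by
  unfold projDeriv
  fun_prop

theorem norm_projDeriv_le (θ : (Fin p → ℝ) × (Fin p → ℝ)) (y : Fin p → ℝ) :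
    ‖projDeriv θ y‖ ≤ p * (‖y - θ.2‖ + ‖θ.1‖) := by
  refine ContinuousLinearMap.opNorm_le_bound _ (by positivity) fun h => ?_
  rw [projDeriv_apply]
  calc ‖∑ k, ((y k - θ.2 k) * h.1 k - θ.1 k * h.2 k)‖
      ≤ ∑ _k : Fin p, (‖y - θ.2‖ + ‖θ.1‖) * ‖h‖ := by
        refine norm_sum_le_of_le _ fun k _ => ?_
        calc _ ≤ ‖(y - θ.2) k‖ * ‖h.1 k‖ + ‖θ.1 k‖ * ‖h.2 k‖ := by
              rw [← norm_mul, ← norm_mul]; exact norm_sub_le _ _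
          _ ≤ ‖y - θ.2‖ * ‖h‖ + ‖θ.1‖ * ‖h‖ := by
              gcongr
              · exact norm_le_pi_norm _ _
              · exact (norm_le_pi_norm _ _).trans (norm_fst_le h)
              · exact norm_le_pi_norm _ _
              · exact (norm_le_pi_norm _ _).trans (norm_snd_le h)
          _ = _ := by ring
    _ = _ := by simp; ring

theorem abs_dotProduct_le (u v : Fin p → ℝ) : |u ⬝ᵥ v| ≤ p * (‖u‖ * ‖v‖) := by
  calc |u ⬝ᵥ v| ≤ ∑ _k : Fin p, ‖u‖ * ‖v‖ := by
        rw [dotProduct, ← Real.norm_eq_abs]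
        refine norm_sum_le_of_le _ fun k _ => ?_
        rw [norm_mul]
        gcongr
        · exact norm_le_pi_norm u k
        · exact norm_le_pi_norm v k
    _ = _ := by simp

end EmpiricalAverages

/-! ### Integrable domination near `(e_j, 0)`. -/

section Domination

variable {Ω : Type*} [MeasurableSpace Ω] {P : Measure Ω} [IsProbabilityMeasure P] {p : ℕ}
  {G : ℝ → ℝ}

theorem IsAdmissible.differentiable_deriv (hG : IsAdmissible G) : Differentiable ℝ (deriv G) := by
  have h := hG.contDiff
  rw [show (2 : WithTop ℕ∞) = 1 + 1 by norm_num, contDiff_succ_iff_deriv] at h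
  exact h.2.2.differentiable one_ne_zero

theorem IsAdmissible.differentiable (hG : IsAdmissible G) : Differentiable ℝ G :=
  hG.contDiff.differentiable two_ne_zero

theorem IsAdmissible.continuous_deriv_deriv (hG : IsAdmissible G) :
    Continuous (deriv (deriv G)) := by
  have h := hG.contDiff
  rw [show (2 : WithTop ℕ∞) = 1 + 1 by norm_num, contDiff_succ_iff_deriv] at h
  exact h.2.2.continuous_deriv le_rfl

/-- For `(u, m)` near `(e_j, 0)` the argument `uᵀ(y - m)` stays within `ε(1 + ‖y‖)` of `y_j`, where
the domination hypothesis controls `g'`. The mean value inequality then reduces `g` to `g(y_j)`, and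
`|g(y_j)|(1 + ‖y‖)` is bounded by squares, which are integrable. A single `H` serves both averages.
-/
theorem exists_dominating {y₀ : Ω → Fin p → ℝ} (hG : IsAdmissible G) (hA2 : IsStandardized P y₀)
    (hA3 : HasMoments P G y₀) (hdom : IsLocallyDominated P G y₀) (j : Fin p) :
    ∃ r > 0, ∃ H : (Fin p → ℝ) → ℝ, Integrable (fun ω => H (y₀ ω)) P ∧
      ∀ y, ∀ θ ∈ Metric.closedBall ((Pi.single j 1, 0) : (Fin p → ℝ) × (Fin p → ℝ)) r,
        |deriv (deriv G) (θ.1 ⬝ᵥ (y - θ.2))| * (1 + ‖y‖) ^ 2 ≤ H y ∧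
        |deriv G (θ.1 ⬝ᵥ (y - θ.2))| * (1 + ‖y‖) ≤ H y ∧
        ‖projDeriv θ y‖ ≤ 3 * p * (1 + ‖y‖) ∧ ‖y - θ.2‖ ≤ 1 + ‖y‖ := by
  obtain ⟨ε, hε, H, -, hHint, hH⟩ := hdom j
  -- The denominator `p + 1` counts the `p` terms of the scalar product `(u - e_j)ᵀ(y - m)`, bounded
  -- in the sup norm, and the shift `m_j`. The first part `2 H` of the majorant is for `g'`, the
  -- rest is for `g`.
  refine ⟨min 1 (ε / (p + 1)), by positivity,
    fun y => 2 * H y + (2 * (1 + ∑ k, y k ^ 2) + deriv G (y j) ^ 2 + 2 * ε * H y), ?_, ?_⟩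
  · refine (hHint.const_mul 2).add (((Integrable.const_mul ?_ 2).add (hA3.sigma j)).add
      (hHint.const_mul (2 * ε)))
    exact (integrable_const 1).add (integrable_finsetSum _ fun k _ => (hA2 k).1.integrable_sq)
  intro y θ hθ
  rw [Metric.mem_closedBall, dist_eq_norm, Prod.norm_def, max_le_iff, le_min_iff, le_min_iff] at hθ
  simp only [Prod.fst_sub, Prod.snd_sub, sub_zero] at hθ
  obtain ⟨⟨hu1, hu⟩, hm1, hm⟩ := hθ
  set u := θ.1
  set m := θ.2
  have hy := norm_nonneg y
  have hym : ‖y - m‖ ≤ 1 + ‖y‖ := (norm_sub_le _ _).trans (by linarith)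
  have hp : (0 : ℝ) < p + 1 := by positivity
  have hH0 : 0 ≤ H y := le_trans (by positivity) (hH y (y j) (by simp; positivity))
  have hy2 : ‖y‖ ^ 2 ≤ ∑ k, y k ^ 2 := by
    have : Nonempty (Fin p) := ⟨j⟩
    obtain ⟨k, hk⟩ : ∃ k, ‖y‖ = ‖y k‖ := by
      obtain ⟨k, -, hk⟩ := Finset.exists_mem_eq_sup' (Finset.univ_nonempty (α := Fin p))
        (fun k => ‖y k‖₊)
      refine ⟨k, ?_⟩
      rw [Pi.norm_def, ← Finset.sup'_eq_sup Finset.univ_nonempty, hk, coe_nnnorm]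
    rw [hk, Real.norm_eq_abs, sq_abs]
    exact Finset.single_le_sum (f := fun k => y k ^ 2) (fun k _ => sq_nonneg _) (Finset.mem_univ k)
  have ht : |u ⬝ᵥ (y - m) - y j| ≤ ε * (1 + ‖y‖) := by
    have e : u ⬝ᵥ (y - m) - y j = (u - Pi.single j 1) ⬝ᵥ (y - m) - m j := by
      rw [sub_dotProduct, single_dotProduct]; simp only [Pi.sub_apply]; ring
    have h1 := abs_dotProduct_le (u - Pi.single j 1) (y - m)
    have h2 : |m j| ≤ ‖m‖ := norm_le_pi_norm m j
    have h3 : (p : ℝ) * (‖u - Pi.single j 1‖ * ‖y - m‖) ≤ p * (ε / (p + 1) * (1 + ‖y‖)) := by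
      gcongr
    have h4 : ε / (p + 1) ≤ ε / (p + 1) * (1 + ‖y‖) :=
      le_mul_of_one_le_right (by positivity) (by linarith)
    have h5 : p * (ε / (p + 1) * (1 + ‖y‖)) + ε / (p + 1) * (1 + ‖y‖) = ε * (1 + ‖y‖) := by
      field_simp
    rw [e]
    have := abs_sub ((u - Pi.single j 1) ⬝ᵥ (y - m)) (m j)
    linarith
  set t := u ⬝ᵥ (y - m)
  have hg' := hH y t ht
  have hg : |deriv G t| * (1 + ‖y‖) ≤
      2 * (1 + ∑ k, y k ^ 2) + deriv G (y j) ^ 2 + 2 * ε * H y := by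
    have hmv : ‖deriv G t - deriv G (y j)‖ ≤ H y / (1 + ‖y‖ ^ 2) * ‖t - y j‖ := by
      refine Convex.norm_image_sub_le_of_norm_deriv_le (s := Metric.closedBall (y j) (ε * (1 + ‖y‖)))
        (fun s _ => hG.differentiable_deriv s) (fun s hs => ?_) (convex_closedBall _ _)
        (Metric.mem_closedBall_self (by positivity)) (by simpa [Real.dist_eq] using ht)
      rw [le_div_iff₀ (by positivity)]
      exact hH y s (by simpa [Real.dist_eq] using hs)
    simp only [Real.norm_eq_abs] at hmv
    have hmv2 : |deriv G t - deriv G (y j)| * (1 + ‖y‖) ≤ 2 * ε * H y := by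
      calc _ ≤ H y / (1 + ‖y‖ ^ 2) * (ε * (1 + ‖y‖)) * (1 + ‖y‖) := by
            gcongr
            exact hmv.trans (by gcongr)
        _ = H y * ε * ((1 + ‖y‖) ^ 2 / (1 + ‖y‖ ^ 2)) := by ring
        _ ≤ H y * ε * 2 := by
            gcongr
            rw [div_le_iff₀ (by positivity)]
            nlinarith [sq_nonneg (1 - ‖y‖)]
        _ = _ := by ring
    have htri : |deriv G t| ≤ |deriv G (y j)| + |deriv G t - deriv G (y j)| := by
      have := abs_add_le (deriv G (y j)) (deriv G t - deriv G (y j))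
      simpa using this
    have hsq : |deriv G (y j)| * (1 + ‖y‖) ≤ 2 * (1 + ∑ k, y k ^ 2) + deriv G (y j) ^ 2 := by
      rw [← sq_abs (deriv G (y j))]
      nlinarith [sq_nonneg (|deriv G (y j)| - (1 + ‖y‖)), sq_nonneg (1 - ‖y‖),
        sq_nonneg (|deriv G (y j)|), sq_nonneg (1 + ‖y‖)]
    nlinarith [mul_le_mul_of_nonneg_right htri (by positivity : 0 ≤ 1 + ‖y‖)]
  have hB0 : 0 ≤ 2 * (1 + ∑ k, y k ^ 2) + deriv G (y j) ^ 2 + 2 * ε * H y :=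
    le_trans (by positivity) hg
  refine ⟨?_, by linarith, ?_, hym⟩
  · have : |deriv (deriv G) t| * (1 + ‖y‖) ^ 2 ≤ 2 * (|deriv (deriv G) t| * (1 + ‖y‖ ^ 2)) := by
      have h2 : (1 + ‖y‖) ^ 2 ≤ 2 * (1 + ‖y‖ ^ 2) := by nlinarith [sq_nonneg (1 - ‖y‖)]
      nlinarith [mul_le_mul_of_nonneg_left h2 (abs_nonneg (deriv (deriv G) t))]
    linarith
  · refine (norm_projDeriv_le θ y).trans ?_
    have hu2 : ‖u‖ ≤ 2 := by
      have h1 : ‖(Pi.single j 1 : Fin p → ℝ)‖ ≤ 1 :=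
        (pi_norm_le_iff_of_nonneg zero_le_one).2 fun k => by
          by_cases h : k = j <;> simp [h]
      have h2 := norm_add_le (u - Pi.single j 1) (Pi.single j 1)
      rw [sub_add_cancel] at h2
      linarith
    calc (p : ℝ) * (‖y - m‖ + ‖u‖) ≤ p * ((1 + ‖y‖) + 2) := by gcongr
      _ ≤ p * (3 * (1 + ‖y‖)) := by gcongr; linarith
      _ = _ := by ring

end Domination

/-! ### Moments of products of independent components. -/

section Population

variable {Ω : Type*} [MeasurableSpace Ω] {P : Measure Ω} {p : ℕ}
  {G : ℝ → ℝ} {y₀ : Ω → Fin p → ℝ}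

theorem integral_comp_mul_eq_zero (hm : Measurable y₀)
    (hind : iIndepFun (fun (j : Fin p) ω => y₀ ω j) P) (hA2 : IsStandardized P y₀) {φ : ℝ → ℝ}
    (hφ : Measurable φ) {j l : Fin p} (hjl : l ≠ j) : ∫ ω, φ (y₀ ω j) * y₀ ω l ∂P = 0 := by
  have hmj : ∀ k, Measurable fun ω => y₀ ω k := fun k => (measurable_pi_apply k).comp hm
  have h := ((hind.indepFun hjl.symm).comp hφ measurable_id).integral_fun_mul_eq_mul_integral
    (hφ.comp (hmj j)).aestronglyMeasurable (measurable_id.comp (hmj l)).aestronglyMeasurable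
  simp only [Function.comp_apply, id_eq] at h
  rw [h, (hA2 l).2.1, mul_zero]

/-- For `k ≠ l` the pair `(z_j, z_k)` is independent of the centred `z_l`, and this includes `k =
j`. For `k = l` the factor `E[z_l²] = 1` splits off. -/
theorem integral_comp_mul_mul (hm : Measurable y₀)
    (hind : iIndepFun (fun (j : Fin p) ω => y₀ ω j) P) (hA2 : IsStandardized P y₀) {φ : ℝ → ℝ}
    (hφ : Measurable φ) {j l : Fin p} (hjl : l ≠ j) (k : Fin p) :
    ∫ ω, φ (y₀ ω j) * y₀ ω k * y₀ ω l ∂P = if k = l then ∫ ω, φ (y₀ ω j) ∂P else 0 := by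
  have hmj : ∀ k, Measurable fun ω => y₀ ω k := fun k => (measurable_pi_apply k).comp hm
  split_ifs with hkl
  · subst hkl
    have hq : Measurable fun t : ℝ => t ^ 2 := by fun_prop
    have h := ((hind.indepFun hjl.symm).comp hφ hq).integral_fun_mul_eq_mul_integral
      (hφ.comp (hmj j)).aestronglyMeasurable (hq.comp (hmj k)).aestronglyMeasurable
    simp only [Function.comp_apply] at h
    rw [(hA2 k).2.2, mul_one] at h
    rw [← h]
    congr 1
    ext ω
    ring
  · have hq : Measurable fun t : ℝ × ℝ => φ t.1 * t.2 := by fun_prop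
    have h := ((hind.indepFun_prodMk hmj j k l hjl.symm hkl).comp hq
      measurable_id).integral_fun_mul_eq_mul_integral
      (hq.comp ((hmj j).prodMk (hmj k))).aestronglyMeasurable
      (measurable_id.comp (hmj l)).aestronglyMeasurable
    simp only [Function.comp_apply, id_eq] at h
    rw [h, (hA2 l).2.1, mul_zero]

end Population

/-! ### Uniform laws for the averages of `G` and of `g` times a component. -/

section UniformLaws

variable {Ω : Type*} [MeasurableSpace Ω] {P : Measure Ω} [IsProbabilityMeasure P] {p : ℕ}
  {G : ℝ → ℝ} {loc : Fin p → ℝ} {A : Matrix (Fin p) (Fin p) ℝ} {x z : ℕ → Ω → Fin p → ℝ}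

/-- The derivative need not be identified: as a weight, this average multiplies `γ_lᵀ T̂(γ_j)`,
whose limit at the identity is `0` for `l ≠ j`. -/
theorem ae_hasUnifStrictFDerivAt_avgG (hG : IsAdmissible G) (hmodel : IsICSample P loc A x z)
    (hA2 : IsStandardized P (z 0)) (hA3 : HasMoments P G (z 0))
    (hdom : IsLocallyDominated P G (z 0)) (j : Fin p) :
    ∃ L, ∀ᵐ ω ∂P, HasUnifStrictFDerivAt (avgG G fun i => z i ω) (nu P G (z 0) j) L
      (Pi.single j 1, 0) := by
  obtain ⟨r, hr, H, hHint, hH⟩ := exists_dominating hG hA2 hA3 hdom j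
  have key := ae_hasUnifStrictFDerivAt_average (P := P) (z := z)
    (F := fun θ y => G (θ.1 ⬝ᵥ (y - θ.2)))
    (F' := fun θ y => deriv G (θ.1 ⬝ᵥ (y - θ.2)) • projDeriv θ y)
    (θ₀ := ((Pi.single j 1, 0) : (Fin p → ℝ) × (Fin p → ℝ))) (H := fun y => 3 * p * H y)
    (hmodel.measurable 0) hmodel.indep_sample hmodel.identDistrib hr
    (fun θ y => (hG.differentiable _).hasDerivAt.comp_hasFDerivAt θ
      (hasFDerivAt_dotProduct_sub θ y))
    ?_ ?_ ?_ (hHint.const_mul _) ?_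
  · refine ⟨_, key.2.mono fun ω hω => hω.congr_deriv ?_ fun _ => rfl⟩
    simp [nu]
  · have := hG.differentiable_deriv.continuous
    have hc : Continuous fun q : (Fin p → ℝ) × (Fin p → ℝ) × (Fin p → ℝ) =>
        deriv G (q.2.1 ⬝ᵥ (q.1 - q.2.2)) := this.comp (by unfold dotProduct; fun_prop)
    exact hc.smul continuous_projDeriv
  · have := hG.differentiable.continuous
    exact (this.comp (by unfold dotProduct; fun_prop)).measurable
  · simpa using hA3.nu j
  · intro y θ hθ
    obtain ⟨-, h2, h3, -⟩ := hH y θ hθ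
    rw [norm_smul, Real.norm_eq_abs]
    calc _ ≤ |deriv G (θ.1 ⬝ᵥ (y - θ.2))| * (3 * p * (1 + ‖y‖)) := by gcongr
      _ = 3 * p * (|deriv G (θ.1 ⬝ᵥ (y - θ.2))| * (1 + ‖y‖)) := by ring
      _ ≤ _ := by gcongr

/-- Only the derivatives with `l ≠ j` are computed, since `γ_lᵀ T̂(γ_j)` differentiated in `γ_j` at
the identity sees only the `l`-th component of `T̂`. -/
theorem ae_hasUnifStrictFDerivAt_avgT (hG : IsAdmissible G) (hmodel : IsICSample P loc A x z)
    (hA2 : IsStandardized P (z 0)) (hA3 : HasMoments P G (z 0))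
    (hdom : IsLocallyDominated P G (z 0)) (j l : Fin p) :
    ∃ L : ((Fin p → ℝ) × (Fin p → ℝ)) →L[ℝ] ℝ,
      (l ≠ j → ∀ h, L h = del P G (z 0) j * h.1 l - mu P G (z 0) j * h.2 l) ∧
      ∀ᵐ ω ∂P, HasUnifStrictFDerivAt (avgT G (fun i => z i ω) l)
        (if l = j then lam P G (z 0) j else 0) L (Pi.single j 1, 0) := by
  obtain ⟨r, hr, H, hHint, hH⟩ := exists_dominating hG hA2 hA3 hdom j
  have hg := hG.differentiable_deriv.continuous
  have hg' := hG.continuous_deriv_deriv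
  have hdot : Continuous fun q : (Fin p → ℝ) × (Fin p → ℝ) × (Fin p → ℝ) =>
    q.2.1 ⬝ᵥ (q.1 - q.2.2) := by unfold dotProduct; fun_prop
  have hmz := hmodel.measurable 0
  have hmk : ∀ k, Measurable fun ω => z 0 ω k := fun k => (measurable_pi_apply k).comp hmz
  have hb : ∀ y : Fin p → ℝ, |deriv (deriv G) (y j)| * (1 + ‖y‖) ^ 2 ≤ H y ∧
      |deriv G (y j)| * (1 + ‖y‖) ≤ H y := by
    intro y
    have := hH y _ (Metric.mem_closedBall_self hr.le)
    simp only [sub_zero, single_dotProduct, one_mul] at this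
    exact ⟨this.1, this.2.1⟩
  let π : Fin p → ((Fin p → ℝ) × (Fin p → ℝ)) →L[ℝ] ℝ := fun l =>
    (ContinuousLinearMap.proj (R := ℝ) (φ := fun _ : Fin p => ℝ) l).comp
      (ContinuousLinearMap.snd ℝ (Fin p → ℝ) (Fin p → ℝ))
  have hπ : ‖π l‖ ≤ 1 := ContinuousLinearMap.opNorm_le_bound _ zero_le_one fun h => by
    rw [one_mul]; exact (norm_le_pi_norm h.2 l).trans (norm_snd_le h)
  have key := ae_hasUnifStrictFDerivAt_average (P := P) (z := z)
    (F := fun θ y => deriv G (θ.1 ⬝ᵥ (y - θ.2)) * (y l - θ.2 l))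
    (F' := fun θ y => (deriv (deriv G) (θ.1 ⬝ᵥ (y - θ.2)) * (y l - θ.2 l)) • projDeriv θ y -
      deriv G (θ.1 ⬝ᵥ (y - θ.2)) • π l)
    (θ₀ := ((Pi.single j 1, 0) : (Fin p → ℝ) × (Fin p → ℝ))) (H := fun y => (3 * p + 1) * H y)
    hmz hmodel.indep_sample hmodel.identDistrib hr
    ?_ ?_ ?_ ?_ (hHint.const_mul _) ?_
  · refine ⟨_, fun hlj h => ?_, key.2.mono fun ω hω => hω.congr_deriv ?_ fun _ => rfl⟩
    · rw [ContinuousLinearMap.integral_apply key.1]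
      have i1 : ∀ k, Integrable (fun ω => deriv (deriv G) (z 0 ω j) * z 0 ω k * z 0 ω l) P := by
        intro k
        refine hHint.mono' (by
          exact (((hg'.measurable.comp (hmk j)).mul (hmk k)).mul (hmk l)).aestronglyMeasurable)
          (ae_of_all _ fun ω => ?_)
        refine le_trans ?_ (hb (z 0 ω)).1
        rw [norm_mul, norm_mul, Real.norm_eq_abs, mul_assoc, sq]
        have h1 := norm_le_pi_norm (z 0 ω) k
        have h2 := norm_le_pi_norm (z 0 ω) l
        gcongr <;> linarith
      have i2 : Integrable (fun ω => deriv (deriv G) (z 0 ω j) * z 0 ω l) P := by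
        refine hHint.mono' (by
          exact ((hg'.measurable.comp (hmk j)).mul (hmk l)).aestronglyMeasurable)
          (ae_of_all _ fun ω => ?_)
        refine le_trans ?_ (hb (z 0 ω)).1
        rw [norm_mul, Real.norm_eq_abs]
        have h2 := norm_le_pi_norm (z 0 ω) l
        gcongr
        nlinarith [norm_nonneg (z 0 ω)]
      have e : ∀ ω, ((deriv (deriv G) ((Pi.single j 1 : Fin p → ℝ) ⬝ᵥ (z 0 ω - 0)) *
            (z 0 ω l - (0 : Fin p → ℝ) l)) • projDeriv (Pi.single j 1, 0) (z 0 ω) -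
          deriv G ((Pi.single j 1 : Fin p → ℝ) ⬝ᵥ (z 0 ω - 0)) • π l) h =
          (∑ k, h.1 k * (deriv (deriv G) (z 0 ω j) * z 0 ω k * z 0 ω l)) -
            h.2 j * (deriv (deriv G) (z 0 ω j) * z 0 ω l) - h.2 l * deriv G (z 0 ω j) := by
        intro ω
        simp only [sub_zero, single_dotProduct, one_mul, Pi.zero_apply, _root_.sub_apply,
          _root_.smul_apply, projDeriv_apply, smul_eq_mul, π, ContinuousLinearMap.comp_apply,
          ContinuousLinearMap.proj_apply, ContinuousLinearMap.coe_snd', Finset.sum_sub_distrib,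
          Pi.single_apply, ite_mul, zero_mul, Finset.sum_ite_eq', Finset.mem_univ, if_true]
        rw [mul_sub, Finset.mul_sum]
        congr 1
        · congr 1
          · exact Finset.sum_congr rfl fun k _ => by ring
          · ring
        · ring
      simp only [e]
      rw [integral_sub, integral_sub, integral_finsetSum]
      -- By independence only `k = l` survives in the sum, with value `δ_j`; the term in `h.2 j` has
      -- mean zero, and the one in `h.2 l` contributes `-μ_j`.
      · simp only [integral_const_mul]
        rw [integral_comp_mul_eq_zero hmz hmodel.indep_components hA2 hg'.measurable hlj]
        simp only [integral_comp_mul_mul hmz hmodel.indep_components hA2 hg'.measurable hlj]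
        simp only [del, mu, mul_ite, mul_zero, Finset.sum_ite_eq', Finset.mem_univ, if_true]
        ring
      · exact fun k _ => (i1 k).const_mul _
      · exact integrable_finsetSum _ fun k _ => (i1 k).const_mul _
      · exact i2.const_mul _
      · exact (integrable_finsetSum _ fun k _ => (i1 k).const_mul _).sub (i2.const_mul _)
      · exact (hA3.mu j).const_mul _
    · simp only [sub_zero, single_dotProduct, one_mul, Pi.zero_apply]
      split_ifs with hlj
      · subst hlj; rfl
      · exact integral_comp_mul_eq_zero hmz hmodel.indep_components hA2 hg.measurable hlj
  · intro θ y
    have h1 := (hG.differentiable_deriv _).hasDerivAt.comp_hasFDerivAt θ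
      (hasFDerivAt_dotProduct_sub θ y)
    have h2 : HasFDerivAt (fun θ : (Fin p → ℝ) × (Fin p → ℝ) => y l - θ.2 l) (-π l) θ :=
      (π l).hasFDerivAt.const_sub (y l)
    refine (h1.mul h2).congr_fderiv ?_
    ext v <;> simp <;> ring
  · exact ((hg'.comp hdot).mul (by fun_prop)).smul continuous_projDeriv |>.sub
      ((hg.comp hdot).smul continuous_const)
  · exact ((hg.comp (by unfold dotProduct; fun_prop)).mul (by fun_prop)).measurable
  · simp only [sub_zero, single_dotProduct, one_mul, Pi.zero_apply]
    refine hHint.mono' ((hg.measurable.comp (hmk j)).mul (hmk l)).aestronglyMeasurable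
      (ae_of_all _ fun ω => ?_)
    refine le_trans ?_ (hb (z 0 ω)).2
    rw [norm_mul, Real.norm_eq_abs]
    have h2 := norm_le_pi_norm (z 0 ω) l
    gcongr
    linarith
  · intro y θ hθ
    obtain ⟨h1, h2, h3, h4⟩ := hH y θ hθ
    have h5 : |y l - θ.2 l| ≤ 1 + ‖y‖ := (norm_le_pi_norm (y - θ.2) l).trans h4
    set t := θ.1 ⬝ᵥ (y - θ.2)
    have h6 : |deriv G t| ≤ H y :=
      (le_mul_of_one_le_right (abs_nonneg _) (by linarith [norm_nonneg y])).trans h2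
    calc _ ≤ ‖(deriv (deriv G) t * (y l - θ.2 l)) • projDeriv θ y‖ + ‖deriv G t • π l‖ :=
          norm_sub_le _ _
      _ ≤ |deriv (deriv G) t| * (1 + ‖y‖) * (3 * p * (1 + ‖y‖)) + |deriv G t| * 1 := by
          rw [norm_smul, norm_smul, norm_mul, Real.norm_eq_abs, Real.norm_eq_abs, Real.norm_eq_abs]
          gcongr
      _ = 3 * p * (|deriv (deriv G) t| * (1 + ‖y‖) ^ 2) + |deriv G t| := by ring
      _ ≤ 3 * p * H y + H y := by gcongr
      _ = _ := by ring

end UniformLaws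

/-! ### The preconditioned system of equations, and measurability of its Newton limit. -/

section NewtonMap

variable {p n : ℕ}

/-- The rows of the identity matrix. -/
def idRows (p : ℕ) : Fin p → Fin p → ℝ := fun j => Pi.single j 1

/-- Deviation from the whitening constraint. -/
noncomputable def whiteRes (X : Fin n → Fin p → ℝ) (Γ : Fin p → Fin p → ℝ) (j l : Fin p) : ℝ :=
  Γ l ⬝ᵥ (sampleCov X *ᵥ Γ j) - if l = j then 1 else 0

/-- Residual of an estimating equation with weights `wa`, `wb`, which depend on the sample, on
a row of the unmixing matrix and on the index of that row. -/
noncomputable def critRes (G : ℝ → ℝ)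
    (wa wb : ∀ n : ℕ, (Fin n → Fin p → ℝ) → (Fin p → ℝ) → Fin p → ℝ)
    (X : Fin n → Fin p → ℝ) (Γ : Fin p → Fin p → ℝ) (j l : Fin p) : ℝ :=
  wa n X (Γ j) j * (Γ l ⬝ᵥ hatT G X (Γ j)) - wb n X (Γ l) l * (Γ j ⬝ᵥ hatT G X (Γ l))

/-- The residuals of all equations, multiplied by the inverse of their limiting derivative. -/
noncomputable def newtonMap (G : ℝ → ℝ)
    (wa wb : ∀ n : ℕ, (Fin n → Fin p → ℝ) → (Fin p → ℝ) → Fin p → ℝ) (κ D : Fin p → Fin p → ℝ)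
    (X : Fin n → Fin p → ℝ) (Γ : Fin p → Fin p → ℝ) : Fin p → Fin p → ℝ := fun j l =>
  if j < l then (D j l)⁻¹ * (κ j l * whiteRes X Γ j l - critRes G wa wb X Γ j l)
  else if l < j then
    whiteRes X Γ l j - (D l j)⁻¹ * (κ l j * whiteRes X Γ l j - critRes G wa wb X Γ l j)
  else 2⁻¹ * whiteRes X Γ j j

/-- The limit of the simplified Newton iteration started at the identity. -/
noncomputable def newtonLimit (G : ℝ → ℝ)
    (wa wb : ∀ n : ℕ, (Fin n → Fin p → ℝ) → (Fin p → ℝ) → Fin p → ℝ) (κ D : Fin p → Fin p → ℝ)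
    (n : ℕ) (X : Fin n → Fin p → ℝ) : Matrix (Fin p) (Fin p) ℝ := fun j l =>
  limsup (fun k => (fun Γ => Γ - newtonMap G wa wb κ D X Γ)^[k] (idRows p) j l) atTop

theorem continuous_sampleCov (j l : Fin p) :
    Continuous fun X : Fin n → Fin p → ℝ => sampleCov X j l := by
  simp only [sampleCov, Matrix.of_apply, sampleMean]
  fun_prop

theorem continuous_hatT {G : ℝ → ℝ} (hg : Continuous (deriv G)) (l : Fin p) :
    Continuous fun q : (Fin n → Fin p → ℝ) × (Fin p → ℝ) => hatT G q.1 q.2 l := by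
  simp only [hatT, Pi.smul_apply, Finset.sum_apply, Pi.sub_apply, sampleMean, smul_eq_mul,
    dotProduct]
  fun_prop

theorem continuous_hatG {G : ℝ → ℝ} (hG : Continuous G) :
    Continuous fun q : (Fin n → Fin p → ℝ) × (Fin p → ℝ) => hatG G q.1 q.2 := by
  simp only [hatG, Pi.sub_apply, sampleMean, dotProduct]
  fun_prop

theorem continuous_srcT {G : ℝ → ℝ} (hg : Continuous (deriv G)) (m : ℝ) (j l : Fin p) :
    Continuous fun Z : Fin n → Fin p → ℝ => srcT G m Z j l := by
  simp only [srcT, Pi.smul_apply, Finset.sum_apply, smul_eq_mul]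
  fun_prop

theorem continuous_srcT2 {G : ℝ → ℝ} (hG : Continuous G) (hg : Continuous (deriv G)) (m : ℝ)
    (j l : Fin p) : Continuous fun Z : Fin n → Fin p → ℝ => srcT2 G m Z j l := by
  simp only [srcT2, Pi.smul_apply, smul_eq_mul]
  have := continuous_srcT (n := n) hg m j l
  fun_prop

variable {G : ℝ → ℝ} {wa wb : ∀ n : ℕ, (Fin n → Fin p → ℝ) → (Fin p → ℝ) → Fin p → ℝ}
  {κ D : Fin p → Fin p → ℝ}

theorem continuous_whiteRes (j l : Fin p) :
    Continuous fun q : (Fin n → Fin p → ℝ) × (Fin p → Fin p → ℝ) => whiteRes q.1 q.2 j l := by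
  have hS : ∀ k m, Continuous fun q : (Fin n → Fin p → ℝ) × (Fin p → Fin p → ℝ) =>
    sampleCov q.1 k m := fun k m => (continuous_sampleCov k m).comp continuous_fst
  simp only [whiteRes, dotProduct, mulVec]
  fun_prop

theorem continuous_critRes (hg : Continuous (deriv G))
    (ha : ∀ j, Continuous fun q : (Fin n → Fin p → ℝ) × (Fin p → ℝ) => wa n q.1 q.2 j)
    (hb : ∀ j, Continuous fun q : (Fin n → Fin p → ℝ) × (Fin p → ℝ) => wb n q.1 q.2 j)
    (j l : Fin p) : Continuous fun q : (Fin n → Fin p → ℝ) × (Fin p → Fin p → ℝ) =>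
      critRes G wa wb q.1 q.2 j l := by
  have hrow : ∀ j, Continuous fun q : (Fin n → Fin p → ℝ) × (Fin p → Fin p → ℝ) =>
      (q.1, q.2 j) := fun j => by fun_prop
  have hT : ∀ j k, Continuous fun q : (Fin n → Fin p → ℝ) × (Fin p → Fin p → ℝ) =>
      hatT G q.1 (q.2 j) k := by
    intro j k
    have h := (continuous_hatT (n := n) hg k).comp (hrow j)
    exact h
  have hC : ∀ j l, Continuous fun q : (Fin n → Fin p → ℝ) × (Fin p → Fin p → ℝ) =>
      q.2 l ⬝ᵥ hatT G q.1 (q.2 j) := by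
    intro j l
    simp only [dotProduct]
    exact continuous_finsetSum _ fun k _ => Continuous.mul (by fun_prop) (hT j k)
  exact (((ha j).comp (hrow j)).mul (hC j l)).sub (((hb l).comp (hrow l)).mul (hC l j))

theorem continuous_newtonMap (hg : Continuous (deriv G))
    (ha : ∀ j, Continuous fun q : (Fin n → Fin p → ℝ) × (Fin p → ℝ) => wa n q.1 q.2 j)
    (hb : ∀ j, Continuous fun q : (Fin n → Fin p → ℝ) × (Fin p → ℝ) => wb n q.1 q.2 j) :
    Continuous fun q : (Fin n → Fin p → ℝ) × (Fin p → Fin p → ℝ) =>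
      newtonMap G wa wb κ D q.1 q.2 := by
  refine continuous_pi fun j => continuous_pi fun l => ?_
  have hW := fun j l => continuous_whiteRes (n := n) (p := p) j l
  have hU := fun j l => continuous_critRes hg ha hb j l
  simp only [newtonMap]
  split_ifs
  · exact continuous_const.mul ((continuous_const.mul (hW j l)).sub (hU j l))
  · exact (hW l j).sub (continuous_const.mul ((continuous_const.mul (hW l j)).sub (hU l j)))
  · exact continuous_const.mul (hW j j)

/-- A `limsup` of continuous functions is measurable whether or not the iteration converges; no
choice of a root is involved. -/
theorem measurable_newtonLimit (hg : Continuous (deriv G))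
    (ha : ∀ j, Continuous fun q : (Fin n → Fin p → ℝ) × (Fin p → ℝ) => wa n q.1 q.2 j)
    (hb : ∀ j, Continuous fun q : (Fin n → Fin p → ℝ) × (Fin p → ℝ) => wb n q.1 q.2 j)
    (j l : Fin p) : Measurable fun X => newtonLimit G wa wb κ D n X j l := by
  refine Measurable.limsup fun k => Continuous.measurable ?_
  have : Continuous fun X : Fin n → Fin p → ℝ =>
      (fun Γ => Γ - newtonMap G wa wb κ D X Γ)^[k] (idRows p) := by
    induction k with
    | zero => exact continuous_const
    | succ k ih =>
      simp only [Function.iterate_succ_apply']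
      exact ih.sub ((continuous_newtonMap hg ha hb).comp (continuous_id.prodMk ih))
  fun_prop

theorem sampleCov_comm (X : Fin n → Fin p → ℝ) (j l : Fin p) :
    sampleCov X j l = sampleCov X l j := by
  simp only [sampleCov, Matrix.of_apply, mul_comm]

theorem whiteRes_comm (X : Fin n → Fin p → ℝ) (Γ : Fin p → Fin p → ℝ) (j l : Fin p) :
    whiteRes X Γ j l = whiteRes X Γ l j := by
  have hS : (sampleCov X)ᵀ = sampleCov X := by
    ext a b
    exact sampleCov_comm X b a
  have : Γ l ⬝ᵥ (sampleCov X *ᵥ Γ j) = Γ j ⬝ᵥ (sampleCov X *ᵥ Γ l) := by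
    rw [dotProduct_mulVec, ← mulVec_transpose, hS, dotProduct_comm]
  simp only [whiteRes, this, eq_comm]

/-- The preconditioning is invertible: the entries `(j, l)` and `(l, j)` add up to the whitening
residual, and the entry `(j, l)` with `j < l` then gives the other residual because `D j l ≠ 0`. -/
theorem isWhitening_and_critRes_of_newtonMap_eq_zero (hD : ∀ j l, j < l → D j l ≠ 0)
    {X : Fin n → Fin p → ℝ} {Γ : Fin p → Fin p → ℝ} (h : newtonMap G wa wb κ D X Γ = 0) :
    IsWhitening X Γ ∧ ∀ j l, j < l → critRes G wa wb X Γ j l = 0 := by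
  have hlt : ∀ j l, j < l → whiteRes X Γ j l = 0 ∧ critRes G wa wb X Γ j l = 0 := by
    intro j l hjl
    have h1 := congr_fun (congr_fun h j) l
    have h2 := congr_fun (congr_fun h l) j
    simp only [newtonMap, hjl, if_true, not_lt.2 hjl.le, if_false, Pi.zero_apply] at h1 h2
    rw [h1, sub_zero] at h2
    refine ⟨h2, ?_⟩
    have := (mul_eq_zero.1 h1).resolve_left (inv_ne_zero (hD j l hjl))
    rw [h2] at this
    linarith
  refine ⟨fun j l => ?_, fun j l hjl => (hlt j l hjl).2⟩
  have hw : whiteRes X Γ j l = 0 := by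
    rcases lt_trichotomy j l with hjl | rfl | hjl
    · exact (hlt j l hjl).1
    · have h1 := congr_fun (congr_fun h j) j
      simp only [newtonMap, lt_irrefl, if_false, Pi.zero_apply] at h1
      linarith
    · rw [whiteRes_comm]
      exact (hlt l j hjl).1
  exact sub_eq_zero.1 hw

end NewtonMap

/-! ### Reduction to one realization of the sources. -/

section Deterministic

variable {p : ℕ}

/-- The mean vector of the first `n` terms. -/
noncomputable def avgMean (y : ℕ → Fin p → ℝ) (n : ℕ) : Fin p → ℝ :=
  fun k => (n : ℝ)⁻¹ * ∑ i ∈ Finset.range n, y i k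

/-- Averages of the centred variables that determine the rate of convergence. -/
noncomputable def rate (G : ℝ → ℝ) (μ : Fin p → ℝ) (y : ℕ → Fin p → ℝ) (n : ℕ) : ℝ :=
  ∑ j, |(n : ℝ)⁻¹ * ∑ i ∈ Finset.range n, y i j| +
  ∑ j, ∑ l, |(n : ℝ)⁻¹ * ∑ i ∈ Finset.range n, (y i j * y i l - if j = l then 1 else 0)| +
  ∑ j, ∑ l, |(n : ℝ)⁻¹ * ∑ i ∈ Finset.range n,
    if l = j then 0 else (deriv G (y i j) - μ j) * y i l|

/-- The limit theorems, for one realization `y` of the sources, on which the asymptotics of the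
estimators rest. -/
structure IsRegularSequence (G : ℝ → ℝ) (μ lm δ : Fin p → ℝ) (y : ℕ → Fin p → ℝ) : Prop where
  mean : Tendsto (avgMean y) atTop (𝓝 0)
  second : ∀ k l, Tendsto (fun n : ℕ => (n : ℝ)⁻¹ * ∑ i ∈ Finset.range n, y i k * y i l) atTop
    (𝓝 (if k = l then 1 else 0))
  avgT : ∀ j l, ∃ L : ((Fin p → ℝ) × (Fin p → ℝ)) →L[ℝ] ℝ,
    (l ≠ j → ∀ h, L h = δ j * h.1 l - μ j * h.2 l) ∧
    HasUnifStrictFDerivAt (avgT G y l) (if l = j then lm j else 0) L (Pi.single j 1, 0)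

/-- `X n` is the sample `y 0, …, y (n - 1)` up to a translation. -/
def IsTranslate (y : ℕ → Fin p → ℝ) (X : ∀ n : ℕ, Fin n → Fin p → ℝ) : Prop :=
  ∀ n (i : Fin n), X n i - sampleMean (X n) = y i - avgMean y n

variable {G : ℝ → ℝ} {μ lm δ : Fin p → ℝ} {y : ℕ → Fin p → ℝ} {X : ∀ n : ℕ, Fin n → Fin p → ℝ}

theorem IsTranslate.hatT_apply (hX : IsTranslate y X) (n : ℕ) (γ : Fin p → ℝ) (l : Fin p) :
    hatT G (X n) γ l = avgT G y l n (γ, avgMean y n) := by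
  simp only [hatT, hX n, Pi.smul_apply, Finset.sum_apply, smul_eq_mul, Pi.sub_apply, avgT]
  rw [← Fin.sum_univ_eq_sum_range
    (fun i => deriv G (γ ⬝ᵥ (y i - avgMean y n)) * (y i l - avgMean y n l))]

theorem IsTranslate.hatG_eq (hX : IsTranslate y X) (n : ℕ) (γ : Fin p → ℝ) :
    hatG G (X n) γ = avgG G y n (γ, avgMean y n) := by
  simp only [hatG, hX n, avgG]
  rw [← Fin.sum_univ_eq_sum_range (fun i => G (γ ⬝ᵥ (y i - avgMean y n)))]

theorem IsTranslate.sampleCov_apply (hX : IsTranslate y X) (n : ℕ) (k l : Fin p) :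
    sampleCov (X n) k l = (n : ℝ)⁻¹ * ∑ i ∈ Finset.range n, y i k * y i l -
      avgMean y n k * avgMean y n l := by
  have h : ∀ (i : Fin n) k, X n i k - sampleMean (X n) k = y i k - avgMean y n k := fun i k =>
    congr_fun (hX n i) k
  simp only [sampleCov, Matrix.of_apply, h]
  rw [Fin.sum_univ_eq_sum_range (fun i => (y i k - avgMean y n k) * (y i l - avgMean y n l))]
  rcases Nat.eq_zero_or_pos n with rfl | hn
  · simp [avgMean]
  have hn' : (n : ℝ) ≠ 0 := by positivity
  have e : ∀ i, (y i k - avgMean y n k) * (y i l - avgMean y n l) =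
      y i k * y i l - y i k * avgMean y n l - avgMean y n k * y i l +
        avgMean y n k * avgMean y n l := fun i => by ring
  have hm : ∀ k, ∑ i ∈ Finset.range n, y i k = n * avgMean y n k := fun k => by
    simp only [avgMean]; field_simp
  simp only [e, Finset.sum_add_distrib, Finset.sum_sub_distrib, ← Finset.sum_mul,
    ← Finset.mul_sum, hm, Finset.sum_const, Finset.card_range, nsmul_eq_mul]
  field_simp
  ring

theorem srcT_eq (m : ℝ) (n : ℕ) (j l : Fin p) :
    srcT G m (fun i : Fin n => y i) j l =
      (n : ℝ)⁻¹ * ∑ i ∈ Finset.range n, (deriv G (y i j) - m) * y i l := by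
  simp only [srcT, Pi.smul_apply, Finset.sum_apply, smul_eq_mul]
  rw [← Fin.sum_univ_eq_sum_range (fun i => (deriv G (y i j) - m) * y i l)]

theorem srcT_eq_avgT_sub (m : ℝ) (n : ℕ) (j l : Fin p) :
    srcT G m (fun i : Fin n => y i) j l =
      avgT G y l n (Pi.single j 1, 0) - m * avgMean y n l := by
  rw [srcT_eq]
  simp only [avgT, avgMean, sub_zero, single_dotProduct, one_mul, Pi.zero_apply, sub_mul,
    Finset.sum_sub_distrib, ← Finset.mul_sum]
  ring

theorem isBigO_rate_mean (G : ℝ → ℝ) (μ : Fin p → ℝ) (y : ℕ → Fin p → ℝ) :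
    avgMean y =O[atTop] rate G μ y := by
  refine isBigO_pi.2 fun k => IsBigO.of_bound 1 (Eventually.of_forall fun n => ?_)
  have h1 : |avgMean y n k| ≤ ∑ j, |(n : ℝ)⁻¹ * ∑ i ∈ Finset.range n, y i j| :=
    Finset.single_le_sum (f := fun j => |(n : ℝ)⁻¹ * ∑ i ∈ Finset.range n, y i j|)
      (fun _ _ => abs_nonneg _) (Finset.mem_univ k)
  rw [one_mul, Real.norm_eq_abs]
  refine le_trans ?_ (le_abs_self _)
  rw [rate, add_assoc]
  refine h1.trans (le_add_of_nonneg_right (add_nonneg ?_ ?_)) <;>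
    exact Finset.sum_nonneg fun _ _ => Finset.sum_nonneg fun _ _ => abs_nonneg _

theorem isBigO_rate_second (G : ℝ → ℝ) (μ : Fin p → ℝ) (y : ℕ → Fin p → ℝ) (j l : Fin p) :
    (fun n : ℕ => (n : ℝ)⁻¹ * ∑ i ∈ Finset.range n, (y i j * y i l - if j = l then 1 else 0))
      =O[atTop] rate G μ y := by
  refine IsBigO.of_bound 1 (Eventually.of_forall fun n => ?_)
  have h1 := Finset.single_le_sum (f := fun j => ∑ l, |(n : ℝ)⁻¹ * ∑ i ∈ Finset.range n,
    (y i j * y i l - if j = l then 1 else 0)|) (fun _ _ => Finset.sum_nonneg fun _ _ => abs_nonneg _) (Finset.mem_univ j)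
  have h2 := Finset.single_le_sum (f := fun l => |(n : ℝ)⁻¹ * ∑ i ∈ Finset.range n,
    (y i j * y i l - if j = l then 1 else 0)|) (fun _ _ => abs_nonneg _) (Finset.mem_univ l)
  rw [one_mul, Real.norm_eq_abs]
  refine le_trans (h2.trans h1) (le_trans ?_ (le_abs_self _))
  rw [rate, add_comm (∑ j, _), add_assoc]
  exact le_add_of_nonneg_right (add_nonneg (Finset.sum_nonneg fun _ _ => abs_nonneg _)
    (Finset.sum_nonneg fun _ _ => Finset.sum_nonneg fun _ _ => abs_nonneg _))

/-- The case `l = j` is excluded: `(g(z_j) - μ_j) z_j` has mean `λ_j` and need not be centred, so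
`rate` omits it. -/
theorem isBigO_rate_srcT (G : ℝ → ℝ) (μ : Fin p → ℝ) (y : ℕ → Fin p → ℝ) {j l : Fin p}
    (hjl : l ≠ j) :
    (fun n : ℕ => srcT G (μ j) (fun i : Fin n => y i) j l) =O[atTop] rate G μ y := by
  refine IsBigO.of_bound 1 (Eventually.of_forall fun n => ?_)
  have h1 := Finset.single_le_sum (f := fun j => ∑ l, |(n : ℝ)⁻¹ * ∑ i ∈ Finset.range n,
    if l = j then 0 else (deriv G (y i j) - μ j) * y i l|) (fun _ _ => Finset.sum_nonneg fun _ _ => abs_nonneg _)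
    (Finset.mem_univ j)
  have h2 := Finset.single_le_sum (f := fun l => |(n : ℝ)⁻¹ * ∑ i ∈ Finset.range n,
    if l = j then 0 else (deriv G (y i j) - μ j) * y i l|) (fun _ _ => abs_nonneg _)
    (Finset.mem_univ l)
  simp only [hjl, if_false] at h2
  rw [one_mul, Real.norm_eq_abs, srcT_eq]
  refine le_trans (h2.trans h1) (le_trans ?_ (le_abs_self _))
  rw [rate]
  exact le_add_of_nonneg_left (add_nonneg (Finset.sum_nonneg fun _ _ => abs_nonneg _)
    (Finset.sum_nonneg fun _ _ => Finset.sum_nonneg fun _ _ => abs_nonneg _))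

end Deterministic

/-! ### Linearization at the identity and the pathwise expansion. -/

section Expansion

variable {p : ℕ} {G : ℝ → ℝ} {μ lm δ α β : Fin p → ℝ} {y : ℕ → Fin p → ℝ}
  {X : ∀ n : ℕ, Fin n → Fin p → ℝ}
  {wa wb : ∀ n : ℕ, (Fin n → Fin p → ℝ) → (Fin p → ℝ) → Fin p → ℝ} {κ D : Fin p → Fin p → ℝ}

/-- The coordinate functional `Γ ↦ Γ j l`. -/
noncomputable def entry (j l : Fin p) : (Fin p → Fin p → ℝ) →L[ℝ] ℝ :=
  (ContinuousLinearMap.proj (R := ℝ) (φ := fun _ : Fin p => ℝ) l).comp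
    (ContinuousLinearMap.proj (R := ℝ) (φ := fun _ : Fin p => Fin p → ℝ) j)

@[simp]
theorem entry_apply (j l : Fin p) (Γ : Fin p → Fin p → ℝ) : entry j l Γ = Γ j l := rfl

theorem idRows_apply (j l : Fin p) : idRows p j l = if l = j then 1 else 0 := by
  simp [idRows, Pi.single_apply]

theorem hasUnifStrictFDerivAt_entry (j l : Fin p) :
    HasUnifStrictFDerivAt (fun _ Γ => Γ j l) (if l = j then 1 else 0) (entry j l) (idRows p) :=
  (HasUnifStrictFDerivAt.clm (entry j l) (idRows p)).congr_deriv
    (by rw [entry_apply, idRows_apply]) fun _ => rfl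

theorem HasUnifStrictFDerivAt.comp_row {f : ℕ → (Fin p → ℝ) → ℝ} {c : ℝ} {L : (Fin p → ℝ) →L[ℝ] ℝ}
    {j : Fin p} (h : HasUnifStrictFDerivAt f c L (Pi.single j 1)) :
    HasUnifStrictFDerivAt (fun n Γ => f n (Γ j)) c
      (L.comp (ContinuousLinearMap.proj (R := ℝ) (φ := fun _ : Fin p => Fin p → ℝ) j))
      (idRows p) :=
  HasUnifStrictFDerivAt.comp (c := (Pi.single j 1 : Fin p → ℝ)) h
    (HasUnifStrictFDerivAt.clm
      (ContinuousLinearMap.proj (R := ℝ) (φ := fun _ : Fin p => Fin p → ℝ) j) (idRows p))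

/-- With the centre frozen at the sample mean, `γ ↦ (γ, m n)` has constant derivative, and its base
point converges to `(u, 0)`. -/
theorem HasUnifStrictFDerivAt.comp_prodMk {f : ℕ → (Fin p → ℝ) × (Fin p → ℝ) → ℝ} {c : ℝ}
    {L : ((Fin p → ℝ) × (Fin p → ℝ)) →L[ℝ] ℝ} {u : Fin p → ℝ} {m : ℕ → Fin p → ℝ}
    (h : HasUnifStrictFDerivAt f c L (u, 0)) (hm : Tendsto m atTop (𝓝 0)) :
    HasUnifStrictFDerivAt (fun n γ => f n (γ, m n)) c
      (L.comp (ContinuousLinearMap.inl ℝ (Fin p → ℝ) (Fin p → ℝ))) u := by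
  refine HasUnifStrictFDerivAt.comp h ⟨tendsto_const_nhds.prodMk_nhds hm, ?_⟩
  simp

theorem tendsto_sampleCov (hy : IsRegularSequence G μ lm δ y) (hX : IsTranslate y X)
    (k l : Fin p) : Tendsto (fun n => sampleCov (X n) k l) atTop (𝓝 (if k = l then 1 else 0)) := by
  simp only [hX.sampleCov_apply]
  have hm := fun k => (tendsto_pi_nhds.1 hy.mean) k
  simpa using (hy.second k l).sub ((hm k).mul (hm l))

theorem hasUnifStrictFDerivAt_whiteRes (hy : IsRegularSequence G μ lm δ y) (hX : IsTranslate y X)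
    (j l : Fin p) : HasUnifStrictFDerivAt (fun n Γ => whiteRes (X n) Γ j l) 0
      (entry l j + entry j l) (idRows p) := by
  have h1 : ∀ k, HasUnifStrictFDerivAt
      (fun n (Γ : Fin p → Fin p → ℝ) => ∑ m, sampleCov (X n) k m * Γ j m) _ _ (idRows p) :=
    fun k => HasUnifStrictFDerivAt.sum_mul (s := Finset.univ)
      (f := fun m n (_ : Fin p → Fin p → ℝ) => sampleCov (X n) k m)
      (fun m => HasUnifStrictFDerivAt.of_tendsto (tendsto_sampleCov hy hX k m))
      (fun m => hasUnifStrictFDerivAt_entry j m)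
  have h2 := (HasUnifStrictFDerivAt.sum_mul (s := Finset.univ)
    (fun k => hasUnifStrictFDerivAt_entry l k) h1).sub
    (HasUnifStrictFDerivAt.of_tendsto (tendsto_const_nhds (x := if l = j then (1 : ℝ) else 0)))
  refine h2.congr_deriv ?_ fun Δ => ?_
  · simp [@eq_comm _ j l]
  · simp [Finset.sum_add_distrib, add_comm]

/-- Product rule: `T̂(e_j)` tends to `λ_j e_j`, so a change of `γ_l` contributes `λ_j Δ_lj`, and a
change of `γ_j` alters the `l`-th component of `T̂` by `δ_j Δ_jl`. -/
theorem hasUnifStrictFDerivAt_dotProduct_hatT (hy : IsRegularSequence G μ lm δ y)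
    (hX : IsTranslate y X) {j l : Fin p} (hjl : l ≠ j) :
    HasUnifStrictFDerivAt (fun n Γ => Γ l ⬝ᵥ hatT G (X n) (Γ j)) 0
      (lm j • entry l j + δ j • entry j l) (idRows p) := by
  choose L hL hT using fun k => hy.avgT j k
  have h1 : ∀ k, HasUnifStrictFDerivAt
      (fun n (Γ : Fin p → Fin p → ℝ) => hatT G (X n) (Γ j) k) _ _ (idRows p) := fun k => by
    simp only [hX.hatT_apply]
    exact ((hT k).comp_prodMk hy.mean).comp_row
  have h2 := HasUnifStrictFDerivAt.sum_mul (s := Finset.univ)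
    (fun k => hasUnifStrictFDerivAt_entry l k) h1
  refine h2.congr_deriv ?_ fun Δ => ?_
  · simp [hjl.symm]
  · simp [Finset.sum_add_distrib, hL l hjl, add_comm]

theorem hasUnifStrictFDerivAt_critRes (hy : IsRegularSequence G μ lm δ y) (hX : IsTranslate y X)
    (ha : ∀ j, ∃ L, HasUnifStrictFDerivAt (fun n γ => wa n (X n) γ j) (α j) L (Pi.single j 1))
    (hb : ∀ j, ∃ L, HasUnifStrictFDerivAt (fun n γ => wb n (X n) γ j) (β j) L (Pi.single j 1))
    {j l : Fin p} (hjl : l ≠ j) :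
    HasUnifStrictFDerivAt (fun n Γ => critRes G wa wb (X n) Γ j l) 0
      (α j • (lm j • entry l j + δ j • entry j l) - β l • (lm l • entry j l + δ l • entry l j))
      (idRows p) := by
  obtain ⟨La, hLa⟩ := ha j
  obtain ⟨Lb, hLb⟩ := hb l
  refine ((hLa.comp_row.mul (hasUnifStrictFDerivAt_dotProduct_hatT hy hX hjl)).sub
    (hLb.comp_row.mul (hasUnifStrictFDerivAt_dotProduct_hatT hy hX hjl.symm))).congr_deriv
    ?_ fun Δ => ?_
  · simp
  · simp

/-- The constant `κ j l` is the coefficient of `Δ_lj` in the derivative of `critRes`. Subtracting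
that derivative from `κ j l (Δ_lj + Δ_jl)` therefore leaves `D j l Δ_jl`. Below the diagonal, `Δ_jl`
is recovered from the whitening equation. -/
theorem hasUnifStrictFDerivAt_newtonMap (hy : IsRegularSequence G μ lm δ y) (hX : IsTranslate y X)
    (ha : ∀ j, ∃ L, HasUnifStrictFDerivAt (fun n γ => wa n (X n) γ j) (α j) L (Pi.single j 1))
    (hb : ∀ j, ∃ L, HasUnifStrictFDerivAt (fun n γ => wb n (X n) γ j) (β j) L (Pi.single j 1))
    (hκ : ∀ j l, κ j l = α j * lm j - β l * δ l)
    (hD : ∀ j l, D j l = α j * (lm j - δ j) + β l * (lm l - δ l))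
    (hD0 : ∀ j l, j < l → D j l ≠ 0) :
    HasUnifStrictFDerivAt (fun n Γ => newtonMap G wa wb κ D (X n) Γ) 0
      (ContinuousLinearMap.id ℝ _) (idRows p) := by
  have hup : ∀ j l, j < l → HasUnifStrictFDerivAt (fun n Γ => (D j l)⁻¹ *
      (κ j l * whiteRes (X n) Γ j l - critRes G wa wb (X n) Γ j l)) 0 (entry j l) (idRows p) := by
    intro j l hjl
    refine ((((hasUnifStrictFDerivAt_whiteRes hy hX j l).const_mul (κ j l)).sub
      (hasUnifStrictFDerivAt_critRes hy hX ha hb hjl.ne')).const_mul (D j l)⁻¹).congr_deriv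
      (by simp) fun Δ => ?_
    have h0 := hD0 j l hjl
    simp only [_root_.smul_apply, _root_.sub_apply, _root_.add_apply, entry_apply, smul_eq_mul]
    rw [inv_mul_eq_iff_eq_mul₀ h0, hκ, hD]
    ring
  refine HasUnifStrictFDerivAt.pi fun j => HasUnifStrictFDerivAt.pi fun l => ?_
  simp only [newtonMap]
  rcases lt_trichotomy j l with hjl | rfl | hjl
  · simp only [hjl, if_true]
    exact (hup j l hjl).congr_deriv rfl fun _ => rfl
  · simp only [lt_irrefl, if_false]
    refine ((hasUnifStrictFDerivAt_whiteRes hy hX j j).const_mul 2⁻¹).congr_deriv (by simp)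
      fun Δ => ?_
    simp only [_root_.smul_apply, _root_.add_apply, entry_apply, smul_eq_mul]
    change 2⁻¹ * (Δ j j + Δ j j) = Δ j j
    ring
  · simp only [hjl, not_lt.2 hjl.le, if_true, if_false]
    refine ((hasUnifStrictFDerivAt_whiteRes hy hX l j).sub (hup l j hjl)).congr_deriv (by simp)
      fun Δ => ?_
    simp only [_root_.sub_apply, _root_.add_apply, entry_apply]
    change Δ j l + Δ l j - Δ l j = Δ j l
    ring

/-- Centring at the sample mean subtracts a product of two means, one factor being `O(rate)` and the
other bounded. -/
theorem isBigO_sampleCov_sub (hy : IsRegularSequence G μ lm δ y) (hX : IsTranslate y X)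
    (k l : Fin p) :
    (fun n => sampleCov (X n) k l - if k = l then 1 else 0) =O[atTop] rate G μ y := by
  have hm := isBigO_rate_mean G μ y
  have h1 : (fun n => avgMean y n k * avgMean y n l) =O[atTop] rate G μ y := by
    have := ((tendsto_pi_nhds.1 hy.mean k).isBigO_one ℝ).mul (isBigO_pi.1 hm l)
    simpa using this
  refine ((isBigO_rate_second G μ y k l).sub h1).congr' ?_ EventuallyEq.rfl
  filter_upwards [eventually_ne_atTop 0] with n hn
  have hn' : (n : ℝ) ≠ 0 := Nat.cast_ne_zero.2 hn
  rw [hX.sampleCov_apply, Finset.sum_sub_distrib, mul_sub]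
  simp only [Finset.sum_const, Finset.card_range, nsmul_eq_mul]
  rw [inv_mul_cancel_left₀ hn']
  ring

/-- Moving the centre from `0` to the sample mean changes `T̂(e_j)_l` by `-μ_j z̄_l` to first order,
which is exactly the term `μ_j` subtracted in `T_j`. -/
theorem isLittleO_hatT_sub_srcT (hy : IsRegularSequence G μ lm δ y) (hX : IsTranslate y X)
    {j l : Fin p} (hjl : l ≠ j) :
    (fun n => hatT G (X n) (Pi.single j 1) l - srcT G (μ j) (fun i : Fin n => y i) j l)
      =o[atTop] rate G μ y := by
  obtain ⟨L, hL, hT⟩ := hy.avgT j l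
  have h1 := hT.isLittleO_comp (u := fun n => (Pi.single j 1, avgMean y n))
    (v := fun _ => (Pi.single j 1, 0)) (tendsto_const_nhds.prodMk_nhds hy.mean) tendsto_const_nhds
  have h2 : (fun n => ((Pi.single j 1, avgMean y n) - (Pi.single j 1, 0) :
      (Fin p → ℝ) × (Fin p → ℝ))) =O[atTop] rate G μ y := by
    simp only [Prod.mk_sub_mk, sub_self, sub_zero]
    exact (isBigO_zero _ _).prod_left (isBigO_rate_mean G μ y)
  refine (h1.trans_isBigO h2).congr_left fun n => ?_
  rw [hL hjl, hX.hatT_apply, srcT_eq_avgT_sub]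
  simp
  ring

/-- Existence of a solution near the identity and its first-order expansion. -/
theorem newtonLimit_expansion (hy : IsRegularSequence G μ lm δ y) (hX : IsTranslate y X)
    (ha : ∀ j, ∃ L, HasUnifStrictFDerivAt (fun n γ => wa n (X n) γ j) (α j) L (Pi.single j 1))
    (hb : ∀ j, ∃ L, HasUnifStrictFDerivAt (fun n γ => wb n (X n) γ j) (β j) L (Pi.single j 1))
    (hκ : ∀ j l, κ j l = α j * lm j - β l * δ l)
    (hD : ∀ j l, D j l = α j * (lm j - δ j) + β l * (lm l - δ l))
    (hD0 : ∀ j l, j < l → D j l ≠ 0) :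
    (∀ᶠ n in atTop, newtonMap G wa wb κ D (X n) (newtonLimit G wa wb κ D n (X n)) = 0) ∧
    Tendsto (fun n => newtonLimit G wa wb κ D n (X n)) atTop (𝓝 (idRows p)) ∧
    (∀ j, (fun n => newtonLimit G wa wb κ D n (X n) j j - 1 -
      (-(1 / 2) * (sampleCov (X n) j j - 1))) =o[atTop] rate G μ y) ∧
    (∀ j l, j < l → (fun n => newtonLimit G wa wb κ D n (X n) l j -
      (-newtonLimit G wa wb κ D n (X n) j l - sampleCov (X n) j l)) =o[atTop] rate G μ y) ∧
    ∀ j l, j < l → (fun n => newtonLimit G wa wb κ D n (X n) j l -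
      (α j * srcT G (μ j) (fun i : Fin n => y i) j l -
        β l * srcT G (μ l) (fun i : Fin n => y i) l j - κ j l * sampleCov (X n) j l) / D j l)
        =o[atTop] rate G μ y := by
  have hΦ := hasUnifStrictFDerivAt_newtonMap hy hX ha hb hκ hD hD0
  obtain ⟨e, he, helim, heo⟩ := exists_zero_of_hasUnifStrictFDerivAt_id hΦ
  set est : ℕ → Fin p → Fin p → ℝ := fun n => newtonLimit G wa wb κ D n (X n) with hest
  -- For large `n` the iterates converge, so the entrywise `limsup` is the root found by the
  -- contraction.
  have hee : e =ᶠ[atTop] est := by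
    filter_upwards [he] with n hn
    ext j l
    have := tendsto_pi_nhds.1 (tendsto_pi_nhds.1 hn.2 j) l
    exact this.limsup_eq.symm
  have hWid : ∀ n j l, whiteRes (X n) (idRows p) j l =
      sampleCov (X n) j l - if j = l then 1 else 0 := by
    intro n j l
    simp only [whiteRes, idRows, single_dotProduct, one_mul, mulVec_single_one, Matrix.col_apply]
    rw [sampleCov_comm]
    simp only [eq_comm]
  have hCid : ∀ n (j l : Fin p), idRows p l ⬝ᵥ hatT G (X n) (idRows p j) =
      hatT G (X n) (Pi.single j 1) l := by
    intro n j l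
    simp [idRows]
  have hWO : ∀ j l, (fun n => whiteRes (X n) (idRows p) j l) =O[atTop] rate G μ y := fun j l => by
    simp only [hWid]
    exact isBigO_sampleCov_sub hy hX j l
  have hTO : ∀ {j l}, l ≠ j → (fun n => hatT G (X n) (Pi.single j 1) l) =O[atTop] rate G μ y := by
    intro j l hjl
    simpa using (isLittleO_hatT_sub_srcT hy hX hjl).isBigO.add (isBigO_rate_srcT G μ y hjl)
  -- Replacing a weight by its limit costs `o(1)` times `T̂(e_j)_l = O(rate)`, so no rate for the
  -- weights is needed.
  have hw : ∀ {w : ∀ n : ℕ, (Fin n → Fin p → ℝ) → (Fin p → ℝ) → Fin p → ℝ} {a : Fin p → ℝ},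
      (∀ j, ∃ L, HasUnifStrictFDerivAt (fun n γ => w n (X n) γ j) (a j) L (Pi.single j 1)) →
      ∀ {j l}, l ≠ j → (fun n => w n (X n) (Pi.single j 1) j * hatT G (X n) (Pi.single j 1) l -
        a j * srcT G (μ j) (fun i : Fin n => y i) j l) =o[atTop] rate G μ y := by
    intro w a h j l hjl
    obtain ⟨L, hL⟩ := h j
    have h1 : (fun n => w n (X n) (Pi.single j 1) j - a j) =o[atTop] fun _ => (1 : ℝ) := by
      rw [isLittleO_one_iff]
      simpa using hL.tendsto.sub_const (a j)
    have h2 := (h1.mul_isBigO (hTO hjl)).congr_right fun n => one_mul _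
    refine (h2.add ((isLittleO_hatT_sub_srcT hy hX hjl).const_mul_left (a j))).congr_left
      fun n => ?_
    ring
  have hUo : ∀ j l, j < l → (fun n => critRes G wa wb (X n) (idRows p) j l -
      (α j * srcT G (μ j) (fun i : Fin n => y i) j l -
        β l * srcT G (μ l) (fun i : Fin n => y i) l j)) =o[atTop] rate G μ y := by
    intro j l hjl
    refine ((hw ha hjl.ne').sub (hw hb hjl.ne)).congr_left fun n => ?_
    simp only [critRes, hCid]
    simp only [idRows]
    ring
  have hUO : ∀ j l, j < l → (fun n => critRes G wa wb (X n) (idRows p) j l) =O[atTop]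
      rate G μ y := by
    intro j l hjl
    have := (hUo j l hjl).isBigO.add (((isBigO_rate_srcT G μ y hjl.ne').const_mul_left (α j)).sub
      ((isBigO_rate_srcT G μ y hjl.ne).const_mul_left (β l)))
    simpa using this
  have hupO : ∀ j l, j < l → (fun n => (D j l)⁻¹ * (κ j l * whiteRes (X n) (idRows p) j l -
      critRes G wa wb (X n) (idRows p) j l)) =O[atTop] rate G μ y := fun j l hjl =>
    (((hWO j l).const_mul_left _).sub (hUO j l hjl)).const_mul_left _
  have hΦO : (fun n => newtonMap G wa wb κ D (X n) (idRows p)) =O[atTop] rate G μ y := by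
    refine isBigO_pi.2 fun j => isBigO_pi.2 fun l => ?_
    simp only [newtonMap]
    rcases lt_trichotomy j l with hjl | rfl | hjl
    · simpa only [hjl, if_true] using hupO j l hjl
    · simpa only [lt_irrefl, if_false] using (hWO j j).const_mul_left _
    · simpa only [hjl, not_lt.2 hjl.le, if_true, if_false] using (hWO l j).sub (hupO l j hjl)
  have hmain : (fun n => est n - idRows p + newtonMap G wa wb κ D (X n) (idRows p)) =o[atTop]
      rate G μ y :=
    (heo.trans_isBigO hΦO).congr' (by filter_upwards [hee] with n hn; rw [hn]) EventuallyEq.rfl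
  have hcomp : ∀ j l, (fun n => est n j l - idRows p j l +
      newtonMap G wa wb κ D (X n) (idRows p) j l) =o[atTop] rate G μ y := fun j l =>
    isLittleO_pi.1 (isLittleO_pi.1 hmain j) l
  refine ⟨?_, helim.congr' hee, fun j => ?_, fun j l hjl => ?_, fun j l hjl => ?_⟩
  · filter_upwards [he, hee] with n hn hn2
    rw [← hn.1, hn2]
  · refine (hcomp j j).congr_left fun n => ?_
    simp only [newtonMap, lt_irrefl, if_false, hWid, idRows_apply, if_true, hest]
    ring
  -- In the sum of the two transposed entries the estimating equation cancels, leaving the whitening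
  -- residual.
  · refine ((hcomp l j).add (hcomp j l)).congr_left fun n => ?_
    simp only [newtonMap, hjl, not_lt.2 hjl.le, if_true, if_false, hWid, idRows_apply, hjl.ne,
      hjl.ne', hest]
    ring
  · refine ((hcomp j l).add ((hUo j l hjl).const_mul_left (D j l)⁻¹)).congr_left fun n => ?_
    simp only [newtonMap, hjl, if_true, hWid, idRows_apply, hjl.ne, hjl.ne', if_false, hest]
    ring

end Expansion

/-! ### From realizations to probability: almost sure regularity and the order of `rate`. -/

section AlmostSure

variable {Ω : Type*} [MeasurableSpace Ω] {P : Measure Ω} {p : ℕ}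
  {G : ℝ → ℝ} {loc : Fin p → ℝ} {x z : ℕ → Ω → Fin p → ℝ}

theorem IsICSample.isTranslate (hmodel : IsICSample P loc 1 x z) (ω : Ω) :
    IsTranslate (fun i => z i ω) (fun n => firstObs x n ω) := by
  intro n i
  have hn : (n : ℝ) ≠ 0 := by
    have := i.pos
    positivity
  have hx : ∀ i k, x i ω k = loc k + z i ω k := fun i k => by
    rw [hmodel.model, one_mulVec, Pi.add_apply]
  ext k
  simp only [firstObs, Pi.sub_apply, sampleMean, avgMean, hx, Finset.sum_add_distrib,
    Finset.sum_const, Finset.card_univ, Fintype.card_fin, nsmul_eq_mul, mul_add,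
    inv_mul_cancel_left₀ hn]
  rw [Fin.sum_univ_eq_sum_range (fun i => z i ω k)]
  ring

theorem IsICSample.measurable_firstObs_source (hmodel : IsICSample P loc 1 x z) (n : ℕ) :
    Measurable fun ω => firstObs z n ω :=
  measurable_pi_lambda _ fun i => hmodel.measurable i

theorem IsICSample.measurable_firstObs (hmodel : IsICSample P loc 1 x z) (n : ℕ) :
    Measurable fun ω => firstObs x n ω := by
  refine measurable_pi_lambda _ fun i => ?_
  have : (fun ω => firstObs x n ω i) = fun ω => loc + z i ω := by
    ext ω k
    simp [firstObs, hmodel.model]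
  rw [this]
  exact (hmodel.measurable i).const_add loc

theorem integral_mul_of_isStandardized {y₀ : Ω → Fin p → ℝ} (hm : Measurable y₀)
    (hind : iIndepFun (fun (j : Fin p) ω => y₀ ω j) P) (hA2 : IsStandardized P y₀) (k l : Fin p) :
    ∫ ω, y₀ ω k * y₀ ω l ∂P = if k = l then 1 else 0 := by
  split_ifs with hkl
  · subst hkl
    simpa only [sq] using (hA2 k).2.2
  · exact integral_comp_mul_eq_zero hm hind hA2 measurable_id (Ne.symm hkl)

theorem IsICSample.ae_isRegularSequence [IsProbabilityMeasure P]
    (hmodel : IsICSample P loc 1 x z) (hG : IsAdmissible G)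
    (hA2 : IsStandardized P (z 0)) (hA3 : HasMoments P G (z 0))
    (hdom : IsLocallyDominated P G (z 0)) :
    ∀ᵐ ω ∂P, IsRegularSequence G (mu P G (z 0)) (lam P G (z 0)) (del P G (z 0))
      fun i => z i ω := by
  have h1 : ∀ᵐ ω ∂P, ∀ k, Tendsto (fun n => avgMean (fun i => z i ω) n k) atTop (𝓝 0) := by
    refine ae_all_iff.2 fun k => ?_
    have := ae_tendsto_average hmodel.indep_sample hmodel.identDistrib
      (φ := fun y : Fin p → ℝ => y k) (measurable_pi_apply k) ((hA2 k).1.integrable one_le_two)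
    rw [(hA2 k).2.1] at this
    exact this
  have h2 : ∀ᵐ ω ∂P, ∀ k l, Tendsto (fun n : ℕ => (n : ℝ)⁻¹ * ∑ i ∈ Finset.range n,
      z i ω k * z i ω l) atTop (𝓝 (if k = l then 1 else 0)) := by
    refine ae_all_iff.2 fun k => ae_all_iff.2 fun l => ?_
    have := ae_tendsto_average hmodel.indep_sample hmodel.identDistrib
      (φ := fun y : Fin p → ℝ => y k * y l) (by fun_prop) ((hA2 k).1.integrable_mul (hA2 l).1)
    rw [integral_mul_of_isStandardized (hmodel.measurable 0) hmodel.indep_components hA2] at this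
    exact this
  choose L hL hT using fun j l => ae_hasUnifStrictFDerivAt_avgT hG hmodel hA2 hA3 hdom j l
  have h3 := ae_all_iff.2 fun j => ae_all_iff.2 fun l => hT j l
  filter_upwards [h1, h2, h3] with ω hω1 hω2 hω3
  exact ⟨tendsto_pi_nhds.2 hω1, hω2, fun j l => ⟨L j l, hL j l, hω3 j l⟩⟩

theorem IsICSample.measurable_rate (hmodel : IsICSample P loc 1 x z) (hG : IsAdmissible G)
    (μ : Fin p → ℝ) (n : ℕ) : Measurable fun ω => rate G μ (fun i => z i ω) n := by
  have hg : Measurable (deriv G) := hG.differentiable_deriv.continuous.measurable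
  have hz : ∀ i k, Measurable fun ω => z i ω k := fun i k =>
    (measurable_pi_apply k).comp (hmodel.measurable i)
  have habs : Measurable fun t : ℝ => |t| := continuous_abs.measurable
  refine ((Finset.measurable_fun_sum _ fun j _ => habs.comp (Measurable.const_mul
    (Finset.measurable_fun_sum _ fun i _ => hz i j) _)).add
    (Finset.measurable_fun_sum _ fun j _ => Finset.measurable_fun_sum _ fun l _ => habs.comp
      (Measurable.const_mul (Finset.measurable_fun_sum _ fun i _ =>
        ((hz i j).mul (hz i l)).sub_const _) _))).add
    (Finset.measurable_fun_sum _ fun j _ => Finset.measurable_fun_sum _ fun l _ => habs.comp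
      (Measurable.const_mul (Finset.measurable_fun_sum _ fun i _ => ?_) _))
  split_ifs
  · exact measurable_const
  · exact ((hg.comp (hz i j)).sub_const _).mul (hz i l)

/-- Each summand averages a centred square integrable variable. Fourth moments give this for `z_j
z_l`, and independence with second moments for `(g(z_j) - μ_j) z_l`, `l ≠ j`. -/
theorem IsICSample.isRootBounded_rate [IsProbabilityMeasure P]
    (hmodel : IsICSample P loc 1 x z) (hG : IsAdmissible G)
    (hA2 : IsStandardized P (z 0)) (hA3 : HasMoments P G (z 0)) :
    IsRootBounded P fun n ω => rate G (mu P G (z 0)) (fun i => z i ω) n := by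
  have hg : Measurable (deriv G) := hG.differentiable_deriv.continuous.measurable
  have hz : ∀ k, Measurable fun ω => z 0 ω k := fun k =>
    (measurable_pi_apply k).comp (hmodel.measurable 0)
  have hB := fun {φ : (Fin p → ℝ) → ℝ} (hφ : Measurable φ) h2 h0 =>
    (isRootBounded_average hmodel.indep_sample hmodel.identDistrib hφ h2 h0).abs
  refine ((IsRootBounded.sum fun j _ => ?_).add
    (IsRootBounded.sum fun j _ => IsRootBounded.sum fun l _ => ?_)).add
    (IsRootBounded.sum fun j _ => IsRootBounded.sum fun l _ => ?_)
  · exact hB (φ := fun y => y j) (measurable_pi_apply j) (hA2 j).1 (hA2 j).2.1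
  · have hL2 : MemLp (fun ω => z 0 ω j * z 0 ω l) 2 P := by
      have hm : Measurable fun ω => z 0 ω j * z 0 ω l := (hz j).mul (hz l)
      rw [memLp_two_iff_integrable_sq hm.aestronglyMeasurable]
      refine ((hA3.beta j).add (hA3.beta l)).mono'
        (((hz j).mul (hz l)).pow_const 2).aestronglyMeasurable (ae_of_all _ fun ω => ?_)
      rw [Real.norm_of_nonneg (sq_nonneg _), Pi.add_apply]
      nlinarith [sq_nonneg (z 0 ω j ^ 2 - z 0 ω l ^ 2), sq_nonneg (z 0 ω j ^ 2),
        sq_nonneg (z 0 ω l ^ 2)]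
    refine hB (φ := fun y => y j * y l - if j = l then 1 else 0) (by fun_prop)
      (hL2.sub (memLp_const _)) ?_
    rw [integral_sub (hL2.integrable one_le_two) (integrable_const _),
      integral_mul_of_isStandardized (hmodel.measurable 0) hmodel.indep_components hA2]
    simp
  · by_cases hlj : l = j
    · simp only [hlj, if_true, Finset.sum_const_zero, mul_zero, abs_zero]
      exact fun ε _ => ⟨1, one_pos, fun n => by simp [not_le.2 one_pos]⟩
    simp only [hlj, if_false]
    have hm : Measurable fun t => deriv G t - mu P G (z 0) j := hg.sub_const _
    have hgL2 : MemLp (fun ω => deriv G (z 0 ω j) - mu P G (z 0) j) 2 P :=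
      ((memLp_two_iff_integrable_sq (hg.comp (hz j)).aestronglyMeasurable).2 (hA3.sigma j)).sub
        (memLp_const _)
    refine hB (φ := fun y => (deriv G (y j) - mu P G (z 0) j) * y l)
      ((hm.comp (measurable_pi_apply j)).mul (measurable_pi_apply l)) ?_ ?_
    · have hm' : Measurable fun ω => (deriv G (z 0 ω j) - mu P G (z 0) j) * z 0 ω l :=
        (hm.comp (hz j)).mul (hz l)
      rw [memLp_two_iff_integrable_sq hm'.aestronglyMeasurable]
      have hind := ((hmodel.indep_components.indepFun (Ne.symm hlj)).comp
        (hm.pow_const 2) (measurable_id.pow_const 2))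
      have := hind.integrable_mul hgL2.integrable_sq (hA2 l).1.integrable_sq
      refine this.congr (ae_of_all _ fun ω => ?_)
      simp [mul_pow]
    · exact integral_comp_mul_eq_zero (hmodel.measurable 0) hmodel.indep_components hA2 hm hlj

theorem IsICSample.isLittleOP_of_ae_isLittleO_rate [IsProbabilityMeasure P]
    (hmodel : IsICSample P loc 1 x z)
    (hG : IsAdmissible G) (hA2 : IsStandardized P (z 0)) (hA3 : HasMoments P G (z 0))
    {R R' : ℕ → Ω → ℝ} (hR : ∀ n, Measurable (R n))
    (h : ∀ᵐ ω ∂P, (fun n => R n ω) =o[atTop] rate G (mu P G (z 0)) fun i => z i ω)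
    (hR' : ∀ (n : ℕ) ω, R' n ω = √n * R n ω) : IsLittleOP P R' := by
  obtain rfl : R' = fun (n : ℕ) ω => √n * R n ω := funext fun n => funext fun ω => hR' n ω
  exact isLittleOP_of_ae_isLittleO hR (hmodel.measurable_rate hG _) h
    (hmodel.isRootBounded_rate hG hA2 hA3)

/-- Estimators that solve the whitening constraint and the estimating equations with weights
`wa`, `wb`, with their expansions. -/
theorem IsICSample.exists_estimator [IsProbabilityMeasure P]
    (hmodel : IsICSample P loc 1 x z) (hG : IsAdmissible G)
    (hA2 : IsStandardized P (z 0)) (hA3 : HasMoments P G (z 0))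
    (hdom : IsLocallyDominated P G (z 0))
    (wa wb : ∀ n : ℕ, (Fin n → Fin p → ℝ) → (Fin p → ℝ) → Fin p → ℝ) (α β : Fin p → ℝ)
    (hac : ∀ n j, Continuous fun q : (Fin n → Fin p → ℝ) × (Fin p → ℝ) => wa n q.1 q.2 j)
    (hbc : ∀ n j, Continuous fun q : (Fin n → Fin p → ℝ) × (Fin p → ℝ) => wb n q.1 q.2 j)
    (ha : ∀ᵐ ω ∂P, ∀ j, ∃ L,
      HasUnifStrictFDerivAt (fun n γ => wa n (firstObs x n ω) γ j) (α j) L (Pi.single j 1))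
    (hb : ∀ᵐ ω ∂P, ∀ j, ∃ L,
      HasUnifStrictFDerivAt (fun n γ => wb n (firstObs x n ω) γ j) (β j) L (Pi.single j 1))
    (hD : ∀ j l, j < l → α j * (lam P G (z 0) j - del P G (z 0) j) +
      β l * (lam P G (z 0) l - del P G (z 0) l) ≠ 0) :
    ∃ est : ∀ n : ℕ, (Fin n → Fin p → ℝ) → Matrix (Fin p) (Fin p) ℝ,
      IsConsistentSolution P x (fun n X Γ => IsWhitening X Γ ∧ ∀ j l, j < l →
        wa n X (Γ j) j * (Γ l ⬝ᵥ hatT G X (Γ j)) = wb n X (Γ l) l * (Γ j ⬝ᵥ hatT G X (Γ l)))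
        est ∧
      (∀ j, IsLittleOP P fun n ω => √n * (est n (firstObs x n ω) j j - 1) -
        (-(1 / 2) * (√n * (sampleCov (firstObs x n ω) j j - 1)))) ∧
      (∀ᵐ ω ∂P, ∀ j l, j < l → (fun n => est n (firstObs x n ω) l j -
        (-est n (firstObs x n ω) j l - sampleCov (firstObs x n ω) j l))
          =o[atTop] rate G (mu P G (z 0)) fun i => z i ω) ∧
      ∀ᵐ ω ∂P, ∀ j l, j < l → (fun n => est n (firstObs x n ω) j l -
        (α j * srcT G (mu P G (z 0) j) (firstObs z n ω) j l -
          β l * srcT G (mu P G (z 0) l) (firstObs z n ω) l j -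
          (α j * lam P G (z 0) j - β l * del P G (z 0) l) * sampleCov (firstObs x n ω) j l) /
            (α j * (lam P G (z 0) j - del P G (z 0) j) +
              β l * (lam P G (z 0) l - del P G (z 0) l)))
          =o[atTop] rate G (mu P G (z 0)) fun i => z i ω := by
  set κ : Fin p → Fin p → ℝ := fun j l => α j * lam P G (z 0) j - β l * del P G (z 0) l with hκ
  set D : Fin p → Fin p → ℝ := fun j l => α j * (lam P G (z 0) j - del P G (z 0) j) +
    β l * (lam P G (z 0) l - del P G (z 0) l) with hDdef
  have hg := hG.differentiable_deriv.continuous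
  have hmeas : ∀ n j l, Measurable fun X => newtonLimit G wa wb κ D n X j l := fun n j l =>
    measurable_newtonLimit hg (hac n) (hbc n) j l
  have hexp := ((hmodel.ae_isRegularSequence hG hA2 hA3 hdom).and (ha.and hb)).mono fun ω hω =>
    newtonLimit_expansion (κ := κ) (D := D) hω.1 (hmodel.isTranslate ω) hω.2.1 hω.2.2
      (fun _ _ => rfl) (fun _ _ => rfl) hD
  refine ⟨fun n X => newtonLimit G wa wb κ D n X, ⟨hmeas, ?_⟩, fun j => ?_, ?_, ?_⟩
  · filter_upwards [hexp] with ω hω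
    refine ⟨?_, fun j l => ?_⟩
    · filter_upwards [hω.1] with n hn
      obtain ⟨h1, h2⟩ := isWhitening_and_critRes_of_newtonMap_eq_zero hD hn
      exact ⟨h1, fun j l hjl => sub_eq_zero.1 (h2 j l hjl)⟩
    · have := tendsto_pi_nhds.1 (tendsto_pi_nhds.1 hω.2.1 j) l
      rw [idRows_apply] at this
      simpa only [Matrix.one_apply, eq_comm] using this
  · have hR : ∀ n, Measurable fun ω => newtonLimit G wa wb κ D n (firstObs x n ω) j j - 1 -
        (-(1 / 2) * (sampleCov (firstObs x n ω) j j - 1)) := fun n =>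
      (((hmeas n j j).comp (hmodel.measurable_firstObs n)).sub_const 1).sub
        ((((continuous_sampleCov j j).measurable.comp
          (hmodel.measurable_firstObs n)).sub_const 1).const_mul _)
    exact hmodel.isLittleOP_of_ae_isLittleO_rate hG hA2 hA3 hR
      (hexp.mono fun ω hω => hω.2.2.1 j) fun n ω => by ring
  · exact hexp.mono fun ω hω => hω.2.2.2.1
  · exact hexp.mono fun ω hω => hω.2.2.2.2

end AlmostSure

/-! ### From pairwise equations to the original ones. -/

section Solutions

variable {n p : ℕ} {G : ℝ → ℝ} {X : Fin n → Fin p → ℝ} {Γ : Matrix (Fin p) (Fin p) ℝ}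

/-- Whitening says `Γ Ŝ Γᵀ = 1`, hence `Ŝ Γᵀ Γ = 1`, so the sum over all rows reproduces `T̂(γ_j)`.
The rows with `l > j` contribute nothing by orthogonality. -/
theorem isDeflationSolution_of_dotProduct_eq_zero (hW : IsWhitening X Γ)
    (h : ∀ j l, j < l → Γ l ⬝ᵥ hatT G X (Γ j) = 0) : IsDeflationSolution G X Γ := by
  refine ⟨fun j => ?_, hW⟩
  set T := hatT G X (Γ j) with hT
  have h1 : Γ * (sampleCov X * Γᵀ) = 1 := by
    ext l k
    have := hW k l
    rw [Matrix.one_apply, ← this]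
    simp only [Matrix.mul_apply, dotProduct, mulVec, Matrix.transpose_apply]
  have h2 : (∑ l ∈ Finset.Iic j, vecMulVec (Γ l) (Γ l)) *ᵥ T = (Γᵀ * Γ) *ᵥ T := by
    have h3 : Γᵀ * Γ = ∑ l, vecMulVec (Γ l) (Γ l) := by
      ext a b
      simp [Matrix.mul_apply, Matrix.sum_apply, vecMulVec_apply]
    rw [h3, Matrix.sum_mulVec, Matrix.sum_mulVec]
    refine Finset.sum_subset (Finset.subset_univ _) fun l _ hl => ?_
    rw [Finset.mem_Iic, not_le] at hl
    rw [vecMulVec_mulVec, h j l hl]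
    simp
  rw [h2, mulVec_mulVec, ← Matrix.mul_assoc, mul_eq_one_comm.1 h1, one_mulVec]

theorem eventually_sign_eq {u : ℕ → ℝ} {c : ℝ} (hu : Tendsto u atTop (𝓝 c)) (hc : c ≠ 0) :
    ∀ᶠ n in atTop, Real.sign (u n) = Real.sign c := by
  rcases hc.lt_or_gt with h | h
  · filter_upwards [hu.eventually_lt_const h] with n hn
    rw [Real.sign_of_neg hn, Real.sign_of_neg h]
  · filter_upwards [hu.eventually_const_lt h] with n hn
    rw [Real.sign_of_pos hn, Real.sign_of_pos h]

end Solutions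

/-! ### The deflation-based, symmetric and squared symmetric estimators. -/

section Estimators

variable {Ω : Type*} [MeasurableSpace Ω] {P : Measure Ω} {p : ℕ}
  {G : ℝ → ℝ} {loc : Fin p → ℝ} {x z : ℕ → Ω → Fin p → ℝ}

theorem IsConsistentSolution.mono {S S' : ∀ n : ℕ, (Fin n → Fin p → ℝ) →
    Matrix (Fin p) (Fin p) ℝ → Prop} {est : ∀ n : ℕ, (Fin n → Fin p → ℝ) →
    Matrix (Fin p) (Fin p) ℝ} (h : IsConsistentSolution P x S est)
    (hS : ∀ᵐ ω ∂P, (∀ j l, Tendsto (fun n => est n (firstObs x n ω) j l) atTop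
        (𝓝 ((1 : Matrix (Fin p) (Fin p) ℝ) j l))) →
      ∀ᶠ n in atTop, S n (firstObs x n ω) (est n (firstObs x n ω)) →
        S' n (firstObs x n ω) (est n (firstObs x n ω))) :
    IsConsistentSolution P x S' est := by
  refine ⟨h.1, ?_⟩
  filter_upwards [h.2, hS] with ω hω hSω
  refine ⟨?_, hω.2⟩
  filter_upwards [hω.1, hSω hω.2] with n hn hn' using hn' hn

theorem IsICSample.exists_deflation [IsProbabilityMeasure P]
    (hmodel : IsICSample P loc 1 x z) (hG : IsAdmissible G)
    (hA2 : IsStandardized P (z 0)) (hA3 : HasMoments P G (z 0))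
    (hdom : IsLocallyDominated P G (z 0))
    (hne : ∀ j l : Fin p, j < l → lam P G (z 0) j ≠ del P G (z 0) j) :
    ∃ est : ∀ n : ℕ, (Fin n → Fin p → ℝ) → Matrix (Fin p) (Fin p) ℝ,
      IsConsistentSolution P x (fun _ X Γ => IsDeflationSolution G X Γ) est ∧
      (∀ j l, l < j → IsLittleOP P fun n ω =>
        √n * est n (firstObs x n ω) j l -
          (-(√n * est n (firstObs x n ω) l j) - √n * sampleCov (firstObs x n ω) j l)) ∧
      (∀ j, IsLittleOP P fun n ω =>
        √n * (est n (firstObs x n ω) j j - 1) -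
          (-(1 / 2) * (√n * (sampleCov (firstObs x n ω) j j - 1)))) ∧
      (∀ j l, j < l → IsLittleOP P fun n ω =>
        √n * est n (firstObs x n ω) j l -
          (√n * srcT G (mu P G (z 0) j) (firstObs z n ω) j l -
              lam P G (z 0) j * (√n * sampleCov (firstObs x n ω) j l)) /
            (lam P G (z 0) j - del P G (z 0) j)) := by
  -- Weights `1` and `0` leave `γ_lᵀ T̂(γ_j) = 0` for `j < l`, with `κ = λ_j` and `D = λ_j - δ_j`.
  obtain ⟨est, hsol, hdiag, hsum, hmain⟩ := hmodel.exists_estimator hG hA2 hA3 hdom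
    (fun _ _ _ _ => 1) (fun _ _ _ _ => 0) (fun _ => 1) (fun _ => 0)
    (fun _ _ => continuous_const) (fun _ _ => continuous_const)
    (ae_of_all _ fun _ _ => ⟨0, .of_tendsto tendsto_const_nhds⟩)
    (ae_of_all _ fun _ _ => ⟨0, .of_tendsto tendsto_const_nhds⟩)
    (fun j l hjl => by simpa using sub_ne_zero.2 (hne j l hjl))
  have hE : ∀ n j l, Measurable fun ω => est n (firstObs x n ω) j l := fun n j l =>
    (hsol.1 n j l).comp (hmodel.measurable_firstObs n)
  have hS : ∀ n j l, Measurable fun ω => sampleCov (firstObs x n ω) j l := fun n j l =>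
    (continuous_sampleCov j l).measurable.comp (hmodel.measurable_firstObs n)
  have hT : ∀ n j l, Measurable fun ω => srcT G (mu P G (z 0) j) (firstObs z n ω) j l :=
    fun n j l => (continuous_srcT hG.differentiable_deriv.continuous _ j l).measurable.comp
      (hmodel.measurable_firstObs_source n)
  refine ⟨est, hsol.mono (ae_of_all _ fun ω _ => Eventually.of_forall fun n hn => ?_),
    fun j l hlj => ?_, hdiag, fun j l hjl => ?_⟩
  · exact isDeflationSolution_of_dotProduct_eq_zero hn.1 fun j l hjl => by simpa using hn.2 j l hjl
  · exact hmodel.isLittleOP_of_ae_isLittleO_rate hG hA2 hA3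
      (fun n => (hE n j l).sub ((hE n l j).neg.sub (hS n l j)))
      (hsum.mono fun ω hω => hω l j hlj) fun n ω => by
        simp only [Pi.sub_apply, Pi.neg_apply]
        rw [sampleCov_comm (firstObs x n ω) j l]
        ring
  · exact hmodel.isLittleOP_of_ae_isLittleO_rate hG hA2 hA3
      (fun n => (hE n j l).sub (((((hT n j l).const_mul _).sub ((hT n l j).const_mul _)).sub
        ((hS n j l).const_mul _)).div_const _))
      (hmain.mono fun ω hω => hω j l hjl) fun n ω => by simp only [Pi.sub_apply]; ring

/-- Estimating equations that are symmetric in the two rows. -/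
theorem IsICSample.exists_symmetric_estimator [IsProbabilityMeasure P]
    (hmodel : IsICSample P loc 1 x z)
    (hG : IsAdmissible G) (hA2 : IsStandardized P (z 0)) (hA3 : HasMoments P G (z 0))
    (hdom : IsLocallyDominated P G (z 0))
    (w : ∀ n : ℕ, (Fin n → Fin p → ℝ) → (Fin p → ℝ) → Fin p → ℝ) (α : Fin p → ℝ)
    (hwc : ∀ n j, Continuous fun q : (Fin n → Fin p → ℝ) × (Fin p → ℝ) => w n q.1 q.2 j)
    (hw : ∀ᵐ ω ∂P, ∀ j, ∃ L,
      HasUnifStrictFDerivAt (fun n γ => w n (firstObs x n ω) γ j) (α j) L (Pi.single j 1))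
    (hnonneg : ∀ j, 0 ≤ α j * (lam P G (z 0) j - del P G (z 0) j))
    (hzero : {j | α j * (lam P G (z 0) j - del P G (z 0) j) = 0}.Subsingleton) :
    ∃ est : ∀ n : ℕ, (Fin n → Fin p → ℝ) → Matrix (Fin p) (Fin p) ℝ,
      IsConsistentSolution P x (fun n X Γ => IsWhitening X Γ ∧ ∀ j l,
        w n X (Γ j) j * (Γ l ⬝ᵥ hatT G X (Γ j)) = w n X (Γ l) l * (Γ j ⬝ᵥ hatT G X (Γ l)))
        est ∧
      (∀ j, IsLittleOP P fun n ω => √n * (est n (firstObs x n ω) j j - 1) -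
        (-(1 / 2) * (√n * (sampleCov (firstObs x n ω) j j - 1)))) ∧
      ∀ᵐ ω ∂P, ∀ j l, l ≠ j → (fun n => est n (firstObs x n ω) j l -
        (α j * srcT G (mu P G (z 0) j) (firstObs z n ω) j l -
          α l * srcT G (mu P G (z 0) l) (firstObs z n ω) l j -
          (α j * lam P G (z 0) j - α l * del P G (z 0) l) * sampleCov (firstObs x n ω) j l) /
            (α j * (lam P G (z 0) j - del P G (z 0) j) +
              α l * (lam P G (z 0) l - del P G (z 0) l)))
          =o[atTop] rate G (mu P G (z 0)) fun i => z i ω := by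
  -- A sum of two nonnegative terms vanishes only if both do, and at most one index has a vanishing
  -- term.
  have hD : ∀ j l, j ≠ l → α j * (lam P G (z 0) j - del P G (z 0) j) +
      α l * (lam P G (z 0) l - del P G (z 0) l) ≠ 0 := by
    intro j l hjl h0
    obtain ⟨h1, h2⟩ := (add_eq_zero_iff_of_nonneg (hnonneg j) (hnonneg l)).1 h0
    exact hjl (hzero h1 h2)
  obtain ⟨est, hsol, hdiag, hsum, hmain⟩ := hmodel.exists_estimator hG hA2 hA3 hdom
    w w α α hwc hwc hw hw fun j l hjl => hD j l hjl.ne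
  refine ⟨est, hsol.mono (ae_of_all _ fun ω _ => Eventually.of_forall fun n hn => ⟨hn.1, ?_⟩),
    hdiag, ?_⟩
  · intro j l
    rcases lt_trichotomy j l with hjl | rfl | hjl
    · exact hn.2 j l hjl
    · rfl
    · exact (hn.2 l j hjl).symm
  · filter_upwards [hsum, hmain] with ω hsω hmω j l hlj
    rcases hlj.lt_or_gt with h | h
    -- Below the diagonal, `-γ_lj - Ŝ_jl` has the same formula because `D - (α_l λ_l - α_j δ_j) =
    -- α_j λ_j - α_l δ_l`.
    · refine ((hsω l j h).sub (hmω l j h)).congr_left fun n => ?_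
      have h0 := hD j l h.ne'
      have h1 := hD l j h.ne
      rw [sampleCov_comm (firstObs x n ω) l j]
      rw [add_comm] at h1
      rw [add_comm (α l * (lam P G (z 0) l - del P G (z 0) l))]
      field_simp
      ring
    · exact hmω j l h

theorem HasUnifStrictFDerivAt.hatG {y : ℕ → Fin p → ℝ} {X : ∀ n : ℕ, Fin n → Fin p → ℝ}
    (hX : IsTranslate y X) (hm : Tendsto (avgMean y) atTop (𝓝 0)) {c : ℝ} {j : Fin p}
    {L : ((Fin p → ℝ) × (Fin p → ℝ)) →L[ℝ] ℝ}
    (h : HasUnifStrictFDerivAt (avgG G y) c L (Pi.single j 1, 0)) :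
    HasUnifStrictFDerivAt (fun n γ => hatG G (X n) γ) c
      (L.comp (ContinuousLinearMap.inl ℝ (Fin p → ℝ) (Fin p → ℝ))) (Pi.single j 1) := by
  simp only [hX.hatG_eq]
  exact h.comp_prodMk hm

theorem IsICSample.ae_hasUnifStrictFDerivAt_hatG [IsProbabilityMeasure P]
    (hmodel : IsICSample P loc 1 x z)
    (hG : IsAdmissible G) (hA2 : IsStandardized P (z 0)) (hA3 : HasMoments P G (z 0))
    (hdom : IsLocallyDominated P G (z 0)) :
    ∀ᵐ ω ∂P, ∀ j, ∃ L, HasUnifStrictFDerivAt (fun n γ => FastICA.hatG G (firstObs x n ω) γ)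
      (nu P G (z 0) j) L (Pi.single j 1) := by
  choose L hL using ae_hasUnifStrictFDerivAt_avgG hG hmodel hA2 hA3 hdom
  filter_upwards [hmodel.ae_isRegularSequence hG hA2 hA3 hdom, ae_all_iff.2 hL] with ω hω hLω j
  exact ⟨_, (hLω j).hatG (hmodel.isTranslate ω) hω.mean⟩

theorem IsICSample.exists_symmetric [IsProbabilityMeasure P]
    (hmodel : IsICSample P loc 1 x z)
    (hG : IsAdmissible G) (hA2 : IsStandardized P (z 0)) (hA3 : HasMoments P G (z 0))
    (hdom : IsLocallyDominated P G (z 0))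
    (hnonneg : ∀ j, 0 ≤ nu P G (z 0) j * (lam P G (z 0) j - del P G (z 0) j))
    (hzero : {j | nu P G (z 0) j * (lam P G (z 0) j - del P G (z 0) j) = 0}.Subsingleton)
    (hnu : ∀ j, nu P G (z 0) j ≠ 0) :
    ∃ est : ∀ n : ℕ, (Fin n → Fin p → ℝ) → Matrix (Fin p) (Fin p) ℝ,
      IsConsistentSolution P x (fun _ X Γ => IsSymmetricSolution G X Γ) est ∧
      (∀ j, IsLittleOP P fun n ω =>
        √n * (est n (firstObs x n ω) j j - 1) -
          (-(1 / 2) * (√n * (sampleCov (firstObs x n ω) j j - 1)))) ∧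
      (∀ j l, l ≠ j → IsLittleOP P fun n ω =>
        √n * est n (firstObs x n ω) j l -
          (√n * srcT G (mu P G (z 0) j) (firstObs z n ω) j l * sgn P G (z 0) j -
              √n * srcT G (mu P G (z 0) l) (firstObs z n ω) l j * sgn P G (z 0) l -
              (lam P G (z 0) j * sgn P G (z 0) j - del P G (z 0) l * sgn P G (z 0) l) *
                (√n * sampleCov (firstObs x n ω) j l)) /
            ((lam P G (z 0) j - del P G (z 0) j) * sgn P G (z 0) j +
              (lam P G (z 0) l - del P G (z 0) l) * sgn P G (z 0) l)) := by
  have hsgn : ∀ j, nu P G (z 0) j * (lam P G (z 0) j - del P G (z 0) j) =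
      |nu P G (z 0) j| * (sgn P G (z 0) j * (lam P G (z 0) j - del P G (z 0) j)) := by
    intro j
    rw [← mul_assoc, sgn]
    congr 1
    rcases (hnu j).lt_or_gt with h | h
    · rw [Real.sign_of_neg h, abs_of_neg h]; ring
    · rw [Real.sign_of_pos h, abs_of_pos h]; ring
  -- The population signs serve as constant weights: the empirical signs are not continuous in the
  -- sample, as the Newton construction requires. They agree with the population signs for large
  -- `n`, since `ν̂(γ_j)` tends to `ν_j ≠ 0`.
  obtain ⟨est, hsol, hdiag, hmain⟩ := hmodel.exists_symmetric_estimator hG hA2 hA3 hdom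
    (fun _ _ _ j => sgn P G (z 0) j) (sgn P G (z 0)) (fun _ _ => continuous_const)
    (ae_of_all _ fun _ _ => ⟨0, .of_tendsto tendsto_const_nhds⟩)
    (fun j => nonneg_of_mul_nonneg_right (hsgn j ▸ hnonneg j) (abs_pos.2 (hnu j)))
    (hzero.anti fun j hj => by
      have hj' : sgn P G (z 0) j * (lam P G (z 0) j - del P G (z 0) j) = 0 := hj
      change nu P G (z 0) j * (lam P G (z 0) j - del P G (z 0) j) = 0
      rw [hsgn, hj', mul_zero])
  have hE : ∀ n j l, Measurable fun ω => est n (firstObs x n ω) j l := fun n j l =>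
    (hsol.1 n j l).comp (hmodel.measurable_firstObs n)
  have hS : ∀ n j l, Measurable fun ω => sampleCov (firstObs x n ω) j l := fun n j l =>
    (continuous_sampleCov j l).measurable.comp (hmodel.measurable_firstObs n)
  have hT : ∀ n j l, Measurable fun ω => srcT G (mu P G (z 0) j) (firstObs z n ω) j l :=
    fun n j l => (continuous_srcT hG.differentiable_deriv.continuous _ j l).measurable.comp
      (hmodel.measurable_firstObs_source n)
  refine ⟨est, hsol.mono ?_, hdiag, fun j l hlj => ?_⟩
  · filter_upwards [hmodel.ae_hasUnifStrictFDerivAt_hatG hG hA2 hA3 hdom] with ω hω hlim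
    have hsign : ∀ᶠ n in atTop, ∀ j, Real.sign (FastICA.hatG G (firstObs x n ω)
        (est n (firstObs x n ω) j)) = sgn P G (z 0) j := by
      refine eventually_all.2 fun j => ?_
      obtain ⟨L, hL⟩ := hω j
      refine eventually_sign_eq (hL.tendsto_comp (tendsto_pi_nhds.2 fun l => ?_)) (hnu j)
      have := hlim j l
      simpa only [Matrix.one_apply, Pi.single_apply, eq_comm] using this
    filter_upwards [hsign] with n hn hcrit
    refine ⟨fun j l => ?_, hcrit.1⟩
    rw [hn j, hn l, mul_comm, hcrit.2 j l, mul_comm]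
  · exact hmodel.isLittleOP_of_ae_isLittleO_rate hG hA2 hA3
      (fun n => (hE n j l).sub (((((hT n j l).const_mul _).sub ((hT n l j).const_mul _)).sub
        ((hS n j l).const_mul _)).div_const _))
      (hmain.mono fun ω hω => hω j l hlj) fun n ω => by simp only [Pi.sub_apply]; ring

theorem IsICSample.exists_squaredSymmetric [IsProbabilityMeasure P]
    (hmodel : IsICSample P loc 1 x z)
    (hG : IsAdmissible G) (hA2 : IsStandardized P (z 0)) (hA3 : HasMoments P G (z 0))
    (hdom : IsLocallyDominated P G (z 0))
    (hnonneg : ∀ j, 0 ≤ nu P G (z 0) j * (lam P G (z 0) j - del P G (z 0) j))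
    (hzero : {j | nu P G (z 0) j * (lam P G (z 0) j - del P G (z 0) j) = 0}.Subsingleton) :
    ∃ est : ∀ n : ℕ, (Fin n → Fin p → ℝ) → Matrix (Fin p) (Fin p) ℝ,
      IsConsistentSolution P x (fun _ X Γ => IsSquaredSymmetricSolution G X Γ) est ∧
      (∀ j, IsLittleOP P fun n ω =>
        √n * (est n (firstObs x n ω) j j - 1) -
          (-(1 / 2) * (√n * (sampleCov (firstObs x n ω) j j - 1)))) ∧
      (∀ j l, l ≠ j → IsLittleOP P fun n ω =>
        √n * est n (firstObs x n ω) j l -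
          (√n * srcT2 G (mu P G (z 0) j) (firstObs z n ω) j l -
              √n * srcT2 G (mu P G (z 0) l) (firstObs z n ω) l j +
              (nu P G (z 0) l * del P G (z 0) l - nu P G (z 0) j * lam P G (z 0) j) *
                (√n * sampleCov (firstObs x n ω) j l)) /
            (nu P G (z 0) j * (lam P G (z 0) j - del P G (z 0) j) +
              nu P G (z 0) l * (lam P G (z 0) l - del P G (z 0) l))) := by
  obtain ⟨est, hsol, hdiag, hmain⟩ := hmodel.exists_symmetric_estimator hG hA2 hA3 hdom
    (fun _ X γ _ => FastICA.hatG G X γ) (nu P G (z 0))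
    (fun _ _ => continuous_hatG hG.differentiable.continuous)
    (hmodel.ae_hasUnifStrictFDerivAt_hatG hG hA2 hA3 hdom) hnonneg hzero
  have hE : ∀ n j l, Measurable fun ω => est n (firstObs x n ω) j l := fun n j l =>
    (hsol.1 n j l).comp (hmodel.measurable_firstObs n)
  have hS : ∀ n j l, Measurable fun ω => sampleCov (firstObs x n ω) j l := fun n j l =>
    (continuous_sampleCov j l).measurable.comp (hmodel.measurable_firstObs n)
  have hT : ∀ n j l, Measurable fun ω => srcT2 G (mu P G (z 0) j) (firstObs z n ω) j l :=
    fun n j l => (continuous_srcT2 hG.differentiable.continuous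
      hG.differentiable_deriv.continuous _ j l).measurable.comp
      (hmodel.measurable_firstObs_source n)
  choose L hL using ae_hasUnifStrictFDerivAt_avgG hG hmodel hA2 hA3 hdom
  -- The general expansion has the factor `ν_j` where `T_{2j}` has the sample average of `G(z_ij)`;
  -- their difference is `o(1)` and multiplies `O(rate)`.
  have hT2 : ∀ᵐ ω ∂P, ∀ j l, l ≠ j → (fun n => srcT2 G (mu P G (z 0) j) (firstObs z n ω) j l -
      nu P G (z 0) j * srcT G (mu P G (z 0) j) (firstObs z n ω) j l)
        =o[atTop] rate G (mu P G (z 0)) fun i => z i ω := by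
    filter_upwards [ae_all_iff.2 hL] with ω hω j l hlj
    have h1 : (fun n => avgG G (fun i => z i ω) n (Pi.single j 1, 0) - nu P G (z 0) j)
        =o[atTop] fun _ => (1 : ℝ) := by
      rw [isLittleO_one_iff]
      simpa using (hω j).tendsto.sub_const (nu P G (z 0) j)
    refine ((h1.mul_isBigO (isBigO_rate_srcT G (mu P G (z 0)) (fun i => z i ω) hlj)).congr_right
      fun n => one_mul _).congr_left fun n => ?_
    have h2 : avgG G (fun i => z i ω) n (Pi.single j 1, 0) =
        (n : ℝ)⁻¹ * ∑ i, G (firstObs z n ω i j) := by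
      simp only [avgG, sub_zero, single_dotProduct, one_mul, firstObs]
      rw [Fin.sum_univ_eq_sum_range (fun i => G (z i ω j))]
    rw [h2, sub_mul]
    rfl
  refine ⟨est, hsol.mono (ae_of_all _ fun ω _ => Eventually.of_forall fun n hn => ⟨?_, hn.1⟩),
    hdiag, fun j l hlj => ?_⟩
  · intro j l
    simp only [hatT2, dotProduct_smul, smul_eq_mul]
    exact hn.2 j l
  · refine hmodel.isLittleOP_of_ae_isLittleO_rate hG hA2 hA3
      (R := fun n ω => est n (firstObs x n ω) j l -
        (srcT2 G (mu P G (z 0) j) (firstObs z n ω) j l -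
          srcT2 G (mu P G (z 0) l) (firstObs z n ω) l j +
          (nu P G (z 0) l * del P G (z 0) l - nu P G (z 0) j * lam P G (z 0) j) *
            sampleCov (firstObs x n ω) j l) /
        (nu P G (z 0) j * (lam P G (z 0) j - del P G (z 0) j) +
          nu P G (z 0) l * (lam P G (z 0) l - del P G (z 0) l)))
      (fun n => (hE n j l).sub ((((hT n j l).sub (hT n l j)).add
        ((hS n j l).const_mul _)).div_const _)) ?_ fun n ω => by ring
    filter_upwards [hmain, hT2] with ω hω hTω
    refine ((hω j l hlj).sub (((hTω j l hlj).sub (hTω l j hlj.symm)).const_mul_left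
      (nu P G (z 0) j * (lam P G (z 0) j - del P G (z 0) j) +
        nu P G (z 0) l * (lam P G (z 0) l - del P G (z 0) l))⁻¹)).congr_left fun n => ?_
    ring

end Estimators

end FastICA

open FastICA in
theorem theorem1 {Ω : Type*} [MeasurableSpace Ω] (P : Measure Ω) [IsProbabilityMeasure P]
    {p : ℕ} (G : ℝ → ℝ) (hG : IsAdmissible G)
    (loc : Fin p → ℝ) (x z : ℕ → Ω → Fin p → ℝ)
    (hmodel : IsICSample P loc 1 x z)
    (hA1 : AtMostOneGaussian P (z 0))
    (hA2 : IsStandardized P (z 0))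
    (hA3 : HasMoments P G (z 0))
    (hdom : IsLocallyDominated P G (z 0))
    (hnonneg : ∀ j, 0 ≤ nu P G (z 0) j * (lam P G (z 0) j - del P G (z 0) j))
    (hzero : {j | nu P G (z 0) j * (lam P G (z 0) j - del P G (z 0) j) = 0}.Subsingleton) :
    -- (i) deflation-based
    ((∀ j l : Fin p, j < l → lam P G (z 0) j ≠ del P G (z 0) j) →
      ∃ est : ∀ n : ℕ, (Fin n → Fin p → ℝ) → Matrix (Fin p) (Fin p) ℝ,
        IsConsistentSolution P x (fun _ X Γ => IsDeflationSolution G X Γ) est ∧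
        (∀ j l, l < j → IsLittleOP P fun n ω =>
          √n * est n (firstObs x n ω) j l -
            (-(√n * est n (firstObs x n ω) l j) - √n * sampleCov (firstObs x n ω) j l)) ∧
        (∀ j, IsLittleOP P fun n ω =>
          √n * (est n (firstObs x n ω) j j - 1) -
            (-(1 / 2) * (√n * (sampleCov (firstObs x n ω) j j - 1)))) ∧
        (∀ j l, j < l → IsLittleOP P fun n ω =>
          √n * est n (firstObs x n ω) j l -
            (√n * srcT G (mu P G (z 0) j) (firstObs z n ω) j l -
                lam P G (z 0) j * (√n * sampleCov (firstObs x n ω) j l)) /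
              (lam P G (z 0) j - del P G (z 0) j))) ∧
    -- (ii) symmetric
    ((∀ j, nu P G (z 0) j ≠ 0) →
      ∃ est : ∀ n : ℕ, (Fin n → Fin p → ℝ) → Matrix (Fin p) (Fin p) ℝ,
        IsConsistentSolution P x (fun _ X Γ => IsSymmetricSolution G X Γ) est ∧
        (∀ j, IsLittleOP P fun n ω =>
          √n * (est n (firstObs x n ω) j j - 1) -
            (-(1 / 2) * (√n * (sampleCov (firstObs x n ω) j j - 1)))) ∧
        (∀ j l, l ≠ j → IsLittleOP P fun n ω =>
          √n * est n (firstObs x n ω) j l -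
            (√n * srcT G (mu P G (z 0) j) (firstObs z n ω) j l * sgn P G (z 0) j -
                √n * srcT G (mu P G (z 0) l) (firstObs z n ω) l j * sgn P G (z 0) l -
                (lam P G (z 0) j * sgn P G (z 0) j - del P G (z 0) l * sgn P G (z 0) l) *
                  (√n * sampleCov (firstObs x n ω) j l)) /
              ((lam P G (z 0) j - del P G (z 0) j) * sgn P G (z 0) j +
                (lam P G (z 0) l - del P G (z 0) l) * sgn P G (z 0) l))) ∧
    -- (iii) squared symmetric
    (∃ est : ∀ n : ℕ, (Fin n → Fin p → ℝ) → Matrix (Fin p) (Fin p) ℝ,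
        IsConsistentSolution P x (fun _ X Γ => IsSquaredSymmetricSolution G X Γ) est ∧
        (∀ j, IsLittleOP P fun n ω =>
          √n * (est n (firstObs x n ω) j j - 1) -
            (-(1 / 2) * (√n * (sampleCov (firstObs x n ω) j j - 1)))) ∧
        (∀ j l, l ≠ j → IsLittleOP P fun n ω =>
          √n * est n (firstObs x n ω) j l -
            (√n * srcT2 G (mu P G (z 0) j) (firstObs z n ω) j l -
                √n * srcT2 G (mu P G (z 0) l) (firstObs z n ω) l j +
                (nu P G (z 0) l * del P G (z 0) l - nu P G (z 0) j * lam P G (z 0) j) *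
                  (√n * sampleCov (firstObs x n ω) j l)) /
              (nu P G (z 0) j * (lam P G (z 0) j - del P G (z 0) j) +
                nu P G (z 0) l * (lam P G (z 0) l - del P G (z 0) l)))) := by
  exact ⟨hmodel.exists_deflation hG hA2 hA3 hdom,
    hmodel.exists_symmetric hG hA2 hA3 hdom hnonneg hzero,
    hmodel.exists_squaredSymmetric hG hA2 hA3 hdom hnonneg hzero⟩
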